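/- **Conventions.** All partitions are finite multisets of positive integers; $|\lambda|$ is the sum and $l(\lambda)$ the number of entries, $(1^m)$ is the partition with $m$ ones, and $(\lambda,1^h)$ is $\lambda$ with $h$ further ones. Let $\lambda_e$ denote the partition whose entries are the even integers that occur an odd number of times in $\lambda$, each listed once; so $l(\lambda_e)=0$ means that every even integer occurs an even number of times in $\lambda$. *Distributions.* An $(s,t)$-distribution $\underline z=\underline x\sqcup\underline y$ consists of $s$ pairs $x_i=(x'_{2i-1},x'_{2i})$ with real $x'_1<\dots<x'_{2s}$ and of reals $y_1<\dots<y_t$ lying in none of the intervals $[x'_{2i-1},x'_{2i}]$. *Tropical covers.* A tropical cover $\varphi:C\to\mathbb R\cup\{\pm\infty\}$ of type $(g,\lambda,\mu,\underline z)$ is a continuous map from a connected metric graph $C$ of first Betti number $g$ with only $1$-valent vertices (leaves) and $3$-valent (inner) vertices such that: the set of images of the inner vertices is the set of points of $\underline z$; leaves are mapped to $\pm\infty$; $\varphi$ is affine of positive integer slope (the weight) on each edge, oriented so that $\varphi$ increases; at each inner vertex the sum of the incoming weights equals that of the outgoing ones; the ends (edges with a leaf) towards $-\infty$ and $+\infty$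 have weights $\lambda$ and $\mu$. An isomorphism is an isometry compatible with the maps. A symmetric cycle (fork) is a pair of inner edges (ends) of equal weight with the same two endpoints (the same inner vertex). *Resolving covers.* $\varphi$ is resolving if each pair $x_i$ is the image of adjacent vertices $v_1,v_2$ ($\varphi(v_1)<\varphi(v_2)$) such that one of the following holds: (a) the two edges of a symmetric fork or cycle merge at $v_1$ to an edge which merges at $v_2$ with a further edge, or the mirror image of this; (b) an edge splits at $v_1$ into $b,c$, and $c$ merges at $v_2$ with an edge $d\ne b$; (c) an edge splits at $v_1$ into two edges which merge again at $v_2$, at least one of them being of even weight. The edges joining the two vertices of a pair are called contractible. $\mathrm{Sym}_3$ (resp. $\mathrm{Sym}_2$) is the set of symmetric cycles and forks without contractible edges that are adjacent (resp. not adjacent) to a contractible edge. *Generalized zigzag covers.* A resolving cover is a generalized zigzag cover if there is a non-empty connected subgraph $S\subset C\setminus \mathrm{Sym}_2$ that contains at least one inner vertex and all contractible edges, whose only even edges are contractible, and such that each connected component of $C\setminus S$ is a tail attached to $S$: a chain of even edges separated by (possibly no) symmetric cycles of odd weight, which ends in a leaf or in a symmetric fork. For an $(s,0)$-distribution $\underline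 z$ let $\mathcal Z_g(\lambda,\mu;\Lambda_{s,0})$ be the set of isomorphism classes of generalized zigzag covers of type $(g,\lambda,\mu,\underline z)$ (only triple points). *Generalized zigzag numbers.* A colouring $\rho$ of $\varphi$ is a set $I$ of symmetric cycles and forks together with a colour, red or blue, for each connected component of the subgraph of even edges outside $I$. A vertex with edge $a$ on one side and edges $b,c$ on the other is positive (resp. negative) if: exactly one edge, $b$ or $c$, is even and it is blue (resp. red); or all three are even, $\{b,c\}\notin I$, and they are blue (resp. red); or $b,c$ are odd, $\{b,c\}\notin I$, and $a$ is red (resp. blue); or $\{b,c\}\in I$ and $a$ is blue (resp. red). The colouring is effective if the two vertices of each pair $x_i$ have the same sign, $\mathrm{Sym}_3\subset I$, and $I$ contains no symmetric cycle with contractible edges. Its multiplicity is $$\operatorname{mult}^{\mathbb R}(\varphi,\rho)=2^{A+B+N-D}\prod_{p}\omega(p),$$ where $A$ is the number of non-contractible inner edges of even weight outside $I$, $B$ is the number of symmetric cycles in $\mathrm{Sym}_3$, $N$ is the number of non-symmetric cycles of two even contractible edges, $D=|\mathrm{Sym}_2|$, and the product is over the symmetric cycles $p\in I$ with $\omega(p)$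 the weight of an edge of $p$. Put $m(\varphi)=0$ if $\operatorname{mult}^{\mathbb R}(\varphi,\rho)$ is odd for an effective colouring $\rho$, and $m(\varphi)=1$ otherwise, and $$z_{g,\lambda,\mu}(h)=\sum_{[\varphi]\in\mathcal Z_g((\lambda,1^h),(\mu,1^h);\Lambda_{s,0})}2^{m(\varphi)},\qquad 2s=l(\lambda)+l(\mu)+2g-2+2h .$$ **Theorem.** Let $\lambda,\mu$ be partitions with $|\lambda|=|\mu|$ and $l(\lambda_e)=l(\mu_e)=0$. 1. There is an integer $n_0\ge 0$, depending only on $\lambda$ and $\mu$, such that for all $g\ge0$ and all $h>n_0+3$ $$|\mathcal Z_g((\lambda,1^h),(\mu,1^h);\Lambda_{s,0})|\ \ge\ |\mathcal Z_0((1^{h-n_0}),(1^{h-n_0});\Lambda_{h-n_0-1,0})|,\qquad 2s=l(\lambda)+l(\mu)+2g-2+2h,$$ whichever distributions are used on the two sides. 2. For every $g\ge 0$, and whichever distributions are used, $$\liminf_{h\to\infty}\frac{\ln z_{g,\lambda,\mu}(h)}{\frac h3\ln h}\ \ge\ 1 .$$ Moreover, for every $m>3$ and every $(m-1,0)$-distribution,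 $$|\mathcal Z_0((1^m),(1^m);\Lambda_{m-1,0})|\ \ge\ \left\lfloor\tfrac{m-1}{3}\right\rfloor! .$$ -/

import Mathlib

open Filter

namespace TropicalZigzag

/-- An `(s,t)`-distribution: `s` pairs of real numbers `x₁ = (x'₁,x'₂) < ... < xₛ = (x'₂ₛ₋₁,x'₂ₛ)` and
`t` real numbers `y₁ < ... < y_t` outside all the closed intervals spanned by the pairs. -/
structure BranchDistribution (s t : ℕ) where
  x : Fin s → ℝ × ℝ
  y : Fin t → ℝ
  fst_lt_snd : ∀ i, (x i).1 < (x i).2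
  snd_lt_fst : ∀ i j, i < j → (x i).2 < (x j).1
  y_strictMono : StrictMono y
  y_notMem : ∀ i j, y j ∉ Set.Icc (x i).1 (x i).2

/-- All `2s+t` points of a distribution. -/
def BranchDistribution.points {s t : ℕ} (z : BranchDistribution s t) : Set ℝ :=
  {r | (∃ i, r = (z.x i).1 ∨ r = (z.x i).2) ∨ ∃ j, r = z.y j}

/-- The data of a map `φ : C → ℝ ∪ {±∞}` from a finite graph `C` that is affine with positive integer
slope on every edge.

`V` is the set of inner vertices of `C` and `E` is the set of edges. Every edge is listed in the
direction in which `φ` increases: it runs from `src e` to `tgt e`, where `none` as a source (target)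
means that the edge is an end whose leaf is mapped to `-∞` (to `+∞`). Each leaf is `1`-valent, hence
belongs to exactly one end, and is not listed separately.
`pos v` is `φ(v)` and `weight e` is the slope of `φ` on `e`.

The metric of `C` is determined by this data: an inner edge from `v` to `w` has length
`(pos w - pos v) / weight e`, and ends have infinite length. -/
structure CoverData where
  V : Type
  E : Type
  [fintypeV : Fintype V]
  [fintypeE : Fintype E]
  [decEqV : DecidableEq V]
  [decEqE : DecidableEq E]
  src : E → Option V
  tgt : E → Option V
  pos : V → ℝ
  weight : E → ℕ

attribute [instance] CoverData.fintypeV CoverData.fintypeE CoverData.decEqV CoverData.decEqE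

namespace CoverData

/-- The edge `e` is incident to the inner vertex `v`. -/
def Inc (φ : CoverData) (e : φ.E) (v : φ.V) : Prop :=
  φ.src e = some v ∨ φ.tgt e = some v

/-- The edge `e` is an end: it is incident to a leaf. -/
def IsEnd (φ : CoverData) (e : φ.E) : Prop :=
  φ.src e = none ∨ φ.tgt e = none

/-- Edges arriving at `v`. -/
def inEdges (φ : CoverData) (v : φ.V) : Finset φ.E :=
  Finset.univ.filter fun e => φ.tgt e = some v

/-- Edges leaving `v`. -/
def outEdges (φ : CoverData) (v : φ.V) : Finset φ.E :=
  Finset.univ.filter fun e => φ.src e = some v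

/-- Ends mapped to a neighbourhood of `-∞`. -/
def leftEnds (φ : CoverData) : Finset φ.E :=
  Finset.univ.filter fun e => φ.src e = none

/-- Ends mapped to a neighbourhood of `+∞`. -/
def rightEnds (φ : CoverData) : Finset φ.E :=
  Finset.univ.filter fun e => φ.tgt e = none

/-- The incidence graph of the cells (inner vertices and open edges) of `C`. A union of cells of `C` that is
open or closed is topologically connected iff it induces a connected subgraph here, and its
connected components are the connected components of that subgraph. (An open edge that is an end is
taken together with its leaf.) -/
def cellGraph (φ : CoverData) : SimpleGraph (φ.V ⊕ φ.E) :=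
  SimpleGraph.fromRel fun a b => ∃ v e, a = Sum.inl v ∧ b = Sum.inr e ∧ φ.Inc e v

/-- `φ` is a tropical cover of type `(g, lam, mu, z)`. -/
structure IsTropicalCover (φ : CoverData) (g : ℕ) (lam mu : Multiset ℕ) {s t : ℕ}
    (z : BranchDistribution s t) : Prop where
  /-- the listed direction of an edge is the one in which `φ` increases -/
  increasing : ∀ e v w, φ.src e = some v → φ.tgt e = some w → φ.pos v < φ.pos w
  weight_pos : ∀ e, 0 < φ.weight e
  trivalent : ∀ v, (φ.inEdges v).card + (φ.outEdges v).card = 3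
  connected : φ.cellGraph.Connected
  /-- the first Betti number of `C` (the number of edges, minus the number of inner vertices and
  leaves, plus one) is `g` -/
  genus : Fintype.card φ.E + 1
    = Fintype.card φ.V + (φ.leftEnds.card + φ.rightEnds.card) + g
  image : Set.range φ.pos = z.points
  balanced : ∀ v, ∑ e ∈ φ.inEdges v, φ.weight e = ∑ e ∈ φ.outEdges v, φ.weight e
  left_profile : φ.leftEnds.val.map φ.weight = lam
  right_profile : φ.rightEnds.val.map φ.weight = mu

/-- An isomorphism of covers: an isomorphism of the graphs compatible with the maps to `ℝ ∪ {±∞}`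
(it is then automatically an isometry). -/
structure Iso (φ ψ : CoverData) where
  onV : φ.V ≃ ψ.V
  onE : φ.E ≃ ψ.E
  src_eq : ∀ e, ψ.src (onE e) = (φ.src e).map onV
  tgt_eq : ∀ e, ψ.tgt (onE e) = (φ.tgt e).map onV
  pos_eq : ∀ v, ψ.pos (onV v) = φ.pos v
  weight_eq : ∀ e, ψ.weight (onE e) = φ.weight e

/-- The identity isomorphism. -/
def Iso.refl (φ : CoverData) : Iso φ φ where
  onV := Equiv.refl _
  onE := Equiv.refl _
  src_eq e := by simp
  tgt_eq e := by simp
  pos_eq _ := rfl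
  weight_eq _ := rfl

/-- The inverse isomorphism. -/
def Iso.symm {φ ψ : CoverData} (f : Iso φ ψ) : Iso ψ φ where
  onV := f.onV.symm
  onE := f.onE.symm
  src_eq e := by
    have h := f.src_eq (f.onE.symm e)
    rw [Equiv.apply_symm_apply] at h
    rw [h]
    cases φ.src (f.onE.symm e) <;> simp
  tgt_eq e := by
    have h := f.tgt_eq (f.onE.symm e)
    rw [Equiv.apply_symm_apply] at h
    rw [h]
    cases φ.tgt (f.onE.symm e) <;> simp
  pos_eq v := by simpa using (f.pos_eq (f.onV.symm v)).symm
  weight_eq e := by simpa using (f.weight_eq (f.onE.symm e)).symm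

/-- The composition of two isomorphisms. -/
def Iso.trans {φ ψ χ : CoverData} (f : Iso φ ψ) (h : Iso ψ χ) : Iso φ χ where
  onV := f.onV.trans h.onV
  onE := f.onE.trans h.onE
  src_eq e := by
    simp only [Equiv.trans_apply, h.src_eq, f.src_eq]
    cases φ.src e <;> simp
  tgt_eq e := by
    simp only [Equiv.trans_apply, h.tgt_eq, f.tgt_eq]
    cases φ.tgt e <;> simp
  pos_eq v := by simp [h.pos_eq, f.pos_eq]
  weight_eq e := by simp [h.weight_eq, f.weight_eq]

/-- A symmetric cycle: two inner edges of the same weight with the same two endpoints. -/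
def IsSymCycle (φ : CoverData) (p : Finset φ.E) : Prop :=
  ∃ e₁ e₂ v w, e₁ ≠ e₂ ∧ p = {e₁, e₂} ∧ φ.weight e₁ = φ.weight e₂ ∧
    φ.src e₁ = some v ∧ φ.src e₂ = some v ∧ φ.tgt e₁ = some w ∧ φ.tgt e₂ = some w

/-- A symmetric fork: two ends of the same weight adjacent to the same inner vertex. -/
def IsSymFork (φ : CoverData) (p : Finset φ.E) : Prop :=
  ∃ e₁ e₂ v, e₁ ≠ e₂ ∧ p = {e₁, e₂} ∧ φ.weight e₁ = φ.weight e₂ ∧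
    φ.IsEnd e₁ ∧ φ.IsEnd e₂ ∧ φ.Inc e₁ v ∧ φ.Inc e₂ v

/-- Symmetric cycles and symmetric forks. -/
def IsSym (φ : CoverData) (p : Finset φ.E) : Prop :=
  φ.IsSymCycle p ∨ φ.IsSymFork p

/-- The admissible local pictures at a pair of adjacent vertices `v₁`, `v₂` with `φ(v₁) < φ(v₂)`. -/
inductive IsResolvingPair (φ : CoverData) (v₁ v₂ : φ.V) : Prop
  /-- Two flags of the same weight, which form a symmetric fork or a symmetric cycle, merge at
  `v₁`, and the resulting edge `c` merges at `v₂` with a further edge `d` (of any parity). -/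
  | mergeMerge (a b c d f : φ.E) :
      φ.inEdges v₁ = {a, b} → φ.outEdges v₁ = {c} →
      φ.inEdges v₂ = {c, d} → φ.outEdges v₂ = {f} →
      φ.IsSym {a, b} → IsResolvingPair φ v₁ v₂
  /-- The mirror image of the preceding picture. -/
  | splitSplit (a b c d f : φ.E) :
      φ.outEdges v₂ = {a, b} → φ.inEdges v₂ = {c} →
      φ.outEdges v₁ = {c, d} → φ.inEdges v₁ = {f} →
      φ.IsSym {a, b} → IsResolvingPair φ v₁ v₂
  /-- The edge `a` splits at `v₁` into `b` and `c`, and `c` merges at `v₂` with an edge `d`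
  different from `b`. All eight parity patterns which the balancing condition permits (the parities of
  `a`, `c` and `d` are free) are admissible. -/
  | splitMerge (a b c d f : φ.E) :
      φ.inEdges v₁ = {a} → φ.outEdges v₁ = {b, c} →
      φ.inEdges v₂ = {c, d} → φ.outEdges v₂ = {f} →
      b ≠ d → IsResolvingPair φ v₁ v₂
  /-- A cycle of two edges between `v₁` and `v₂`: either an odd edge splits into an odd and an even
  edge, or an even edge splits into two even edges, and the two edges merge again. -/
  | cycle (a b c f : φ.E) :
      φ.inEdges v₁ = {a} → φ.outEdges v₁ = {b, c} →
      φ.inEdges v₂ = {b, c} → φ.outEdges v₂ = {f} →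
      Even (φ.weight c) → IsResolvingPair φ v₁ v₂

/-- The resolving condition: each pair of the distribution is the image of two adjacent vertices that look
like one of the admissible pictures. -/
def IsResolving (φ : CoverData) {s t : ℕ} (z : BranchDistribution s t) : Prop :=
  ∀ i, ∃ v₁ v₂, φ.pos v₁ = (z.x i).1 ∧ φ.pos v₂ = (z.x i).2 ∧ φ.IsResolvingPair v₁ v₂

/-- Contractible edges: the edges that connect the two vertices of a pair. -/
def IsContractible (φ : CoverData) {s t : ℕ} (z : BranchDistribution s t) (e : φ.E) : Prop :=
  ∃ i v₁ v₂, φ.pos v₁ = (z.x i).1 ∧ φ.pos v₂ = (z.x i).2 ∧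
    φ.src e = some v₁ ∧ φ.tgt e = some v₂

/-- The cycle or fork `p` is adjacent to a contractible edge. -/
def AdjContractible (φ : CoverData) {s t : ℕ} (z : BranchDistribution s t) (p : Finset φ.E) : Prop :=
  ∃ c, φ.IsContractible z c ∧ ∃ e ∈ p, ∃ v, φ.Inc c v ∧ φ.Inc e v

/-- `Sym₃`: symmetric cycles and forks without contractible edges that are adjacent to a contractible
edge. -/
def IsSym3 (φ : CoverData) {s t : ℕ} (z : BranchDistribution s t) (p : Finset φ.E) : Prop :=
  φ.IsSym p ∧ (∀ e ∈ p, ¬ φ.IsContractible z e) ∧ φ.AdjContractible z p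

/-- `Sym₂`: symmetric cycles and forks without contractible edges that are not adjacent to a contractible
edge. -/
def IsSym2 (φ : CoverData) {s t : ℕ} (z : BranchDistribution s t) (p : Finset φ.E) : Prop :=
  φ.IsSym p ∧ (∀ e ∈ p, ¬ φ.IsContractible z e) ∧ ¬ φ.AdjContractible z p

/-- `IsTail u e K`: the set of cells `K` is a tail whose first edge `e` is attached to the vertex `u`
(which does not belong to the tail). A tail is a chain of even edges separated by symmetric cycles of odd
weight, terminated by a leaf or by a symmetric fork. (By balancing, the even edges next to a cycle of
odd weight `o` have weight `2o`, and so a fork after a cycle has odd weight, whereas a fork without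
cycles may have any weight.) -/
inductive IsTail (φ : CoverData) : φ.V → φ.E → Set (φ.V ⊕ φ.E) → Prop
  | leaf (u : φ.V) (e : φ.E) :
      φ.Inc e u → φ.IsEnd e → Even (φ.weight e) →
      IsTail φ u e {Sum.inr e}
  | fork (u v : φ.V) (e e₁ e₂ : φ.E) :
      φ.Inc e u → φ.Inc e v → u ≠ v →
      φ.IsSymFork {e₁, e₂} → e₁ ≠ e₂ → φ.Inc e₁ v → φ.Inc e₂ v →
      IsTail φ u e {Sum.inr e, Sum.inl v, Sum.inr e₁, Sum.inr e₂}
  | cycle (u v w : φ.V) (e c₁ c₂ e' : φ.E) (K : Set (φ.V ⊕ φ.E)) :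
      φ.Inc e u → φ.Inc e v → u ≠ v →
      φ.IsSymCycle {c₁, c₂} → c₁ ≠ c₂ → φ.Inc c₁ v → φ.Inc c₁ w → v ≠ w → Odd (φ.weight c₁) →
      e ≠ c₁ → e ≠ c₂ → e' ≠ c₁ → e' ≠ c₂ →
      IsTail φ w e' K →
      IsTail φ u e ({Sum.inr e, Sum.inl v, Sum.inr c₁, Sum.inr c₂, Sum.inl w} ∪ K)

/-- The requirements on the subgraph `S`, given by its inner vertices and its edges, in the definition of a
generalized zigzag cover. -/
structure IsZigzagCore (φ : CoverData) {s t : ℕ} (z : BranchDistribution s t)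
    (S : Set (φ.V ⊕ φ.E)) : Prop where
  /-- `S` is a subgraph -/
  closed : ∀ e v, Sum.inr e ∈ S → φ.Inc e v → Sum.inl v ∈ S
  /-- `S` is non-empty and connected -/
  connected : (φ.cellGraph.induce S).Connected
  /-- `S` is contained in the complement of `Sym₂` -/
  avoids_sym2 : ∀ p, φ.IsSym2 z p → ∀ e ∈ p, Sum.inr e ∉ S
  contractible_mem : ∀ e, φ.IsContractible z e → Sum.inr e ∈ S
  exists_vertex : ∃ v, Sum.inl v ∈ S
  even_contractible : ∀ e, Sum.inr e ∈ S → Even (φ.weight e) → φ.IsContractible z e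
  /-- the connected components of the complement of `S` are tails attached to `S` -/
  tails : ∀ K : (φ.cellGraph.induce Sᶜ).ConnectedComponent,
    ∃ u e, Sum.inl u ∈ S ∧ φ.IsTail u e (Subtype.val '' K.supp)

/-- `φ` is a generalized zigzag cover of type `(g, lam, mu, z)`. -/
structure IsGenZigzag (φ : CoverData) (g : ℕ) (lam mu : Multiset ℕ) {s t : ℕ}
    (z : BranchDistribution s t) : Prop where
  cover : φ.IsTropicalCover g lam mu z
  resolving : φ.IsResolving z
  core : ∃ S : Set (φ.V ⊕ φ.E), φ.IsZigzagCore z S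

/-- A colouring of a cover: a set `I` of symmetric cycles and forks, and a colour (`true` is blue and
`false` is red) for each connected component of the subgraph of the even edges outside `I`. The value
of `colour` on other edges has no meaning and is never used. -/
structure Colouring (φ : CoverData) where
  I : Finset (Finset φ.E)
  I_sym : ∀ p ∈ I, φ.IsSym p
  colour : φ.E → Bool
  colour_eq : ∀ e e' v, φ.Inc e v → φ.Inc e' v →
    Even (φ.weight e) → Even (φ.weight e') → (∀ p ∈ I, e ∉ p) → (∀ p ∈ I, e' ∉ p) →
    colour e = colour e'

/-- The vertex `v` has the edge `a` on one side and the edges `b`, `c` on the other side. -/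
def IsStar (φ : CoverData) (v : φ.V) (a b c : φ.E) : Prop :=
  (φ.inEdges v = {a} ∧ φ.outEdges v = {b, c}) ∨ (φ.outEdges v = {a} ∧ φ.inEdges v = {b, c})

/-- The sign of a vertex of a coloured cover (`true` is positive and `false` is negative). -/
def HasSign (φ : CoverData) (ρ : φ.Colouring) (v : φ.V) (b : Bool) : Prop :=
  ∃ e e₁ e₂, φ.IsStar v e e₁ e₂ ∧
    ((Odd (φ.weight e) ∧ Odd (φ.weight e₁) ∧ Even (φ.weight e₂) ∧ ρ.colour e₂ = b) ∨
     (Even (φ.weight e) ∧ Even (φ.weight e₁) ∧ Even (φ.weight e₂) ∧ {e₁, e₂} ∉ ρ.I ∧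
        ρ.colour e = b ∧ ρ.colour e₁ = b ∧ ρ.colour e₂ = b) ∨
     (Even (φ.weight e) ∧ Odd (φ.weight e₁) ∧ Odd (φ.weight e₂) ∧ {e₁, e₂} ∉ ρ.I ∧
        ρ.colour e = !b) ∨
     (Even (φ.weight e) ∧ {e₁, e₂} ∈ ρ.I ∧ ρ.colour e = b))

/-- Effective colourings: the two vertices of each pair have the same sign, `I` contains `Sym₃`, and
`I` contains no symmetric cycle of contractible edges. -/
structure IsEffective (φ : CoverData) {s t : ℕ} (z : BranchDistribution s t) (ρ : φ.Colouring) :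
    Prop where
  same_sign : ∀ i v₁ v₂, φ.pos v₁ = (z.x i).1 → φ.pos v₂ = (z.x i).2 →
    ∃ b, φ.HasSign ρ v₁ b ∧ φ.HasSign ρ v₂ b
  sym3_mem : ∀ p, φ.IsSym3 z p → p ∈ ρ.I
  contractible_notMem : ∀ p, φ.IsSymCycle p → (∃ e ∈ p, φ.IsContractible z e) → p ∉ ρ.I

/-- The inner edges of even weight outside `I` that are not contractible. -/
def evenInnerEdges (φ : CoverData) {s t : ℕ} (z : BranchDistribution s t) (ρ : φ.Colouring) : Set φ.E :=
  {e | ¬ φ.IsEnd e ∧ Even (φ.weight e) ∧ (∀ p ∈ ρ.I, e ∉ p) ∧ ¬ φ.IsContractible z e}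

/-- The non-symmetric cycles consisting of two even contractible edges. -/
def nonsymContractibleCycles (φ : CoverData) {s t : ℕ} (z : BranchDistribution s t) :
    Set (Finset φ.E) :=
  {p | ∃ e₁ e₂, p = {e₁, e₂} ∧ φ.weight e₁ ≠ φ.weight e₂ ∧
    φ.src e₁ = φ.src e₂ ∧ φ.tgt e₁ = φ.tgt e₂ ∧
    φ.IsContractible z e₁ ∧ φ.IsContractible z e₂ ∧ Even (φ.weight e₁) ∧ Even (φ.weight e₂)}

open Classical in
/-- The real multiplicity of a coloured cover. The two edges of a symmetric cycle have the same weight, and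
`p.sup φ.weight` is this weight. -/
noncomputable def realMult (φ : CoverData) {s t : ℕ} (z : BranchDistribution s t) (ρ : φ.Colouring) : ℚ :=
  2 ^ ((φ.evenInnerEdges z ρ).ncard + {p | φ.IsSymCycle p ∧ φ.IsSym3 z p}.ncard +
      (φ.nonsymContractibleCycles z).ncard)
    / 2 ^ {p | φ.IsSym2 z p}.ncard
    * ∏ p ∈ ρ.I.filter (fun p => φ.IsSymCycle p), ((p.sup φ.weight : ℕ) : ℚ)

open Classical in
/-- `m(φ)`: it is `0` if the real multiplicity of an effective colouring of `φ` is an odd integer, and `1`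
otherwise. -/
noncomputable def parityExponent (φ : CoverData) {s t : ℕ} (z : BranchDistribution s t) : ℕ :=
  if ∃ ρ : φ.Colouring, φ.IsEffective z ρ ∧ ∃ n : ℤ, Odd n ∧ φ.realMult z ρ = n then 0 else 1

end CoverData

/-- Generalized zigzag covers of type `(g, lam, mu, z)`. -/
def GenZigzagCover (g : ℕ) (lam mu : Multiset ℕ) {s t : ℕ} (z : BranchDistribution s t) : Type 1 :=
  {φ : CoverData // φ.IsGenZigzag g lam mu z}

/-- Isomorphism of generalized zigzag covers. -/
instance genZigzagSetoid (g : ℕ) (lam mu : Multiset ℕ) {s t : ℕ} (z : BranchDistribution s t) :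
    Setoid (GenZigzagCover g lam mu z) where
  r φ ψ := Nonempty (CoverData.Iso φ.1 ψ.1)
  iseqv :=
    { refl := fun φ => ⟨CoverData.Iso.refl φ.1⟩
      symm := fun ⟨f⟩ => ⟨f.symm⟩
      trans := fun ⟨f⟩ ⟨h⟩ => ⟨f.trans h⟩ }

/-- The set of isomorphism classes of generalized zigzag covers of type `(g, lam, mu, z)`. -/
def GenZigzagClasses (g : ℕ) (lam mu : Multiset ℕ) {s t : ℕ} (z : BranchDistribution s t) : Type 1 :=
  Quotient (genZigzagSetoid g lam mu z)

/-- The generalized zigzag number of type `(g, lam, mu, z)`: the sum of `2 ^ m(φ)` over the isomorphism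
classes of generalized zigzag covers. -/
noncomputable def genZigzagNumber (g : ℕ) (lam mu : Multiset ℕ) {s t : ℕ} (z : BranchDistribution s t) : ℕ :=
  ∑ᶠ c : GenZigzagClasses g lam mu z, 2 ^ ((Quotient.out c).1.parityExponent z)

/-- The part `λ_e` of the tail decomposition of a partition: the even numbers that occur an odd number of
times, each listed once. -/
def evenTail (lam : Multiset ℕ) : Multiset ℕ :=
  lam.dedup.filter fun n => Even n ∧ Odd (lam.count n)

/-- The partition `(λ, 1^h)`. -/
def addOnes (lam : Multiset ℕ) (h : ℕ) : Multiset ℕ :=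
  lam + Multiset.replicate h 1

/-- The number `s` of triple branch points when there are only triple branch points:
`2s = l(λ) + l(μ) + 2g - 2`. -/
def tripleCount (g : ℕ) (lam mu : Multiset ℕ) : ℕ :=
  (lam.card + mu.card + 2 * g - 2) / 2

/-- The number of triple branch points satisfies the Riemann-Hurwitz equation for the types considered here. -/
theorem two_mul_tripleCount {d : ℕ} (lam mu : Nat.Partition d) (g h : ℕ) (hh : 0 < h)
    (hl : (evenTail lam.parts).card = 0) (hm : (evenTail mu.parts).card = 0) :
    2 * tripleCount g (addOnes lam.parts h) (addOnes mu.parts h) + 2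
      = lam.parts.card + mu.parts.card + 2 * g + 2 * h := by
  have key : ∀ p : Multiset ℕ, (evenTail p).card = 0 → p.card % 2 = p.sum % 2 := by
    intro p hp
    have h0 : ∀ n ∈ p, Even n → Even (p.count n) := by
      intro n hn he
      by_contra hodd
      have hmem : n ∈ evenTail p := by
        simp only [evenTail, Multiset.mem_filter, Multiset.mem_dedup]
        exact ⟨hn, he, Nat.not_even_iff_odd.mp hodd⟩
      rw [Multiset.card_eq_zero] at hp
      simp [hp] at hmem
    have h1 : p.card = ∑ n ∈ p.toFinset, p.count n := (Multiset.toFinset_sum_count_eq p).symm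
    have h2 : p.sum = ∑ n ∈ p.toFinset, p.count n * n := by
      rw [Finset.sum_multiset_count]; simp
    rw [h1, h2]
    change Nat.ModEq 2 _ _
    rw [← ZMod.natCast_eq_natCast_iff]
    push_cast
    refine Finset.sum_congr rfl fun n hn => ?_
    rw [Multiset.mem_toFinset] at hn
    rcases Nat.even_or_odd n with he | ho
    · have : ((p.count n : ℕ) : ZMod 2) = 0 :=
        (ZMod.natCast_eq_zero_iff_even).mpr (h0 n hn he)
      simp [this]
    · have : ((n : ℕ) : ZMod 2) = 1 := (ZMod.natCast_eq_one_iff_odd).mpr ho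
      simp [this]
  have h1 := key _ hl
  have h2 := key _ hm
  rw [lam.parts_sum] at h1
  rw [mu.parts_sum] at h2
  simp only [tripleCount, addOnes, Multiset.card_add, Multiset.card_replicate]
  omega

end TropicalZigzag

open TropicalZigzag

/-! When all branch points come in pairs, the zigzag condition becomes local. By Riemann-Hurwitz a
cover has exactly $2s$ inner vertices, so they map bijectively to the points of the distribution,
and each vertex is joined to its partner by a contractible edge. A core $S$ therefore contains every
inner vertex, the tails are single even ends, and $\mathrm{Sym}_2$ is empty. A generalized zigzag
cover is thus a resolving cover all of whose even inner edges are contractible (`isGenZigzag_iff`).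
Only the order of the branch points matters, so the counts do not depend on the distribution and may
be made over the pairs $(0,1),(2,3),\dots$

Covers of this kind can be prolonged to the right: a gadget with two vertices at $2n$ and $2n+1$ is
glued to an end of odd weight towards $+\infty$ (`IsPointed.glue`). The glued end becomes an inner
edge, but an odd one, and the even inner edges of the gadget are contractible. The end has to be
free, that is, share its vertex with no other end towards $+\infty$, since otherwise the gluing
could destroy a symmetric fork on which an older pair depends. Truncating below $2n$ undoes the
gluing up to isomorphism, so prolongation is injective on isomorphism classes. `Extends` packages
such prolongations so that they can be composed.

Comparison of counts: a cover with profiles $(1^{n+1})$ and genus $0$ has a free end of weight $1$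
(`exists_isFreeEnd`, applied in `exists_isPointed`). Its weight is raised to $3$; from there gadgets
insert each odd part and each pair of equal parts of $\lambda$ and $\mu$, and each unit of genus,
returning to weight $3$ every time; finally the weight is lowered to $1$. This adds $d+2$ ones to
either side, whence $n_0=d+2$ (`extends_partitions`).

Factorial growth: free ends of weight $1$ not in use are kept as spares. A round of three pairs
glues a merging gadget to any one of $j+2$ available free ends, creates one new spare, and returns
to weight $1$. The chosen end can be read off from the resulting cover
(`eq_of_iso_glue_mergeMerge`), so the number of classes is multiplied by $j+2$ (`exists_family`).
Stirling's bound and $2^{m(\varphi)}\ge1$ give the asymptotic statement. -/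

namespace TropicalZigzag

/-! ### The ordered points of a distribution -/

namespace BranchDistribution

variable {s : ℕ}

/-- The points of the pairs of a distribution, indexed by the pair and the position in the pair. -/
def pt (z : BranchDistribution s 0) (i : Fin s × Bool) : ℝ :=
  if i.2 then (z.x i.1).2 else (z.x i.1).1

@[simp] theorem pt_true (z : BranchDistribution s 0) (i : Fin s) : z.pt (i, true) = (z.x i).2 := rfl

@[simp] theorem pt_false (z : BranchDistribution s 0) (i : Fin s) : z.pt (i, false) = (z.x i).1 := rfl

theorem pt_lt_of_lt (z : BranchDistribution s 0) {i j : Fin s} (h : i < j) (b c : Bool) :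
    z.pt (i, b) < z.pt (j, c) := by
  have h1 := z.snd_lt_fst i j h
  have h2 := z.fst_lt_snd i
  have h3 := z.fst_lt_snd j
  cases b <;> cases c <;> simp only [pt_true, pt_false] <;> linarith

theorem pt_lt_iff (z : BranchDistribution s 0) (i j : Fin s) (b c : Bool) :
    z.pt (i, b) < z.pt (j, c) ↔ i < j ∨ (i = j ∧ b = false ∧ c = true) := by
  rcases lt_trichotomy i j with h | rfl | h
  · simp [h, z.pt_lt_of_lt h]
  · have := z.fst_lt_snd i
    cases b <;> cases c <;> simp [this, this.le]
  · simp [h.not_gt, h.ne', (z.pt_lt_of_lt h c b).le]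

theorem pt_injective (z : BranchDistribution s 0) : Function.Injective z.pt := by
  rintro ⟨i, b⟩ ⟨j, c⟩ h
  rcases lt_trichotomy i j with hij | rfl | hij
  · exact absurd h (z.pt_lt_of_lt hij b c).ne
  · have := z.fst_lt_snd i
    cases b <;> cases c <;> simp at h ⊢ <;> linarith
  · exact absurd h (z.pt_lt_of_lt hij c b).ne'

theorem points_eq_range (z : BranchDistribution s 0) : z.points = Set.range z.pt := by
  ext r
  simp only [points, Set.mem_ofPred_eq, Set.mem_range, Prod.exists, Bool.exists_bool, pt_true,
    pt_false, IsEmpty.exists_iff, or_false, eq_comm]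

theorem fst_inj (z : BranchDistribution s 0) {i j : Fin s} : (z.x i).1 = (z.x j).1 ↔ i = j := by
  rw [← pt_false, ← pt_false, z.pt_injective.eq_iff]; simp

theorem fst_ne_snd (z : BranchDistribution s 0) (i j : Fin s) : (z.x i).1 ≠ (z.x j).2 := by
  rw [← pt_true, ← pt_false, Ne, z.pt_injective.eq_iff]; simp

end BranchDistribution

/-! ### Riemann-Hurwitz and the bound on the weights -/

namespace CoverData

theorem mem_inEdges {φ : CoverData} {e : φ.E} {v : φ.V} : e ∈ φ.inEdges v ↔ φ.tgt e = some v := by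
  simp [inEdges]

theorem mem_outEdges {φ : CoverData} {e : φ.E} {v : φ.V} : e ∈ φ.outEdges v ↔ φ.src e = some v := by
  simp [outEdges]

theorem mem_leftEnds {φ : CoverData} {e : φ.E} : e ∈ φ.leftEnds ↔ φ.src e = none := by
  simp [leftEnds]

theorem mem_rightEnds {φ : CoverData} {e : φ.E} : e ∈ φ.rightEnds ↔ φ.tgt e = none := by
  simp [rightEnds]

/-- Summing over the fibres of a partially defined map. -/
theorem sum_filter_eq_none_add {α β M : Type*} [Fintype α] [Fintype β] [DecidableEq β]
    [AddCommMonoid M] (f : α → Option β) (w : α → M) :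
    ∑ e with f e = none, w e + ∑ b, ∑ e with f e = some b, w e = ∑ e, w e := by
  rw [← Fintype.sum_option (f := fun b => ∑ e with f e = b, w e)]
  exact Finset.sum_fiberwise_of_maps_to (fun _ _ => Finset.mem_univ _) _

namespace IsTropicalCover

variable {φ : CoverData} {g s t : ℕ} {L R : Multiset ℕ} {z : BranchDistribution s t}

theorem card_leftEnds (h : φ.IsTropicalCover g L R z) : φ.leftEnds.card = L.card := by
  rw [← h.left_profile, Multiset.card_map]; rfl

theorem card_rightEnds (h : φ.IsTropicalCover g L R z) : φ.rightEnds.card = R.card := by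
  rw [← h.right_profile, Multiset.card_map]; rfl

/-- The Riemann-Hurwitz formula. -/
theorem card_V (h : φ.IsTropicalCover g L R z) :
    Fintype.card φ.V + 2 = L.card + R.card + 2 * g := by
  have h1 := sum_filter_eq_none_add φ.src (fun _ => 1)
  have h2 := sum_filter_eq_none_add φ.tgt (fun _ => 1)
  have h3 : ∑ v, ((φ.inEdges v).card + (φ.outEdges v).card) = ∑ v : φ.V, 3 :=
    Finset.sum_congr rfl fun v _ => h.trivalent v
  have h4 := h.genus
  have h5 := h.card_leftEnds
  have h6 := h.card_rightEnds
  simp only [inEdges, outEdges, leftEnds, rightEnds, Finset.sum_add_distrib, Finset.sum_const,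
    Finset.card_univ, smul_eq_mul, mul_one] at *
  omega

theorem card_E (h : φ.IsTropicalCover g L R z) :
    Fintype.card φ.E = 2 * L.card + 2 * R.card + 3 * g - 3 := by
  have h1 := h.card_V
  have h4 := h.genus
  rw [h.card_leftEnds, h.card_rightEnds] at h4
  omega

theorem pos_mem (h : φ.IsTropicalCover g L R z) (v : φ.V) : φ.pos v ∈ z.points :=
  h.image ▸ Set.mem_range_self v

/-- The vertices map onto the $2s$ points of the distribution, and Riemann-Hurwitz says that there
are only $2s$ of them. -/
theorem pos_injective {z : BranchDistribution s 0} (h : φ.IsTropicalCover g L R z)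
    (hs : 2 * s + 2 = L.card + R.card + 2 * g) : Function.Injective φ.pos := by
  have h1 := h.card_V
  have h2 : (Finset.univ.image φ.pos).card = Fintype.card φ.V := by
    have : Finset.univ.image φ.pos = Finset.univ.image z.pt := by
      apply Finset.coe_injective
      simp [h.image, z.points_eq_range]
    rw [this, Finset.card_image_of_injective _ z.pt_injective]
    simp
    omega
  have := Finset.card_image_iff.mp (h2.trans Finset.card_univ.symm)
  simpa using this

/-- The weight of every edge is at most the degree. -/
theorem weight_le (h : φ.IsTropicalCover g L R z) (e : φ.E) : φ.weight e ≤ L.sum := by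
  have hL : L.sum = ∑ e ∈ φ.leftEnds, φ.weight e := by rw [← h.left_profile]; rfl
  rw [hL]
  rcases hv : φ.src e with _ | v
  · exact Finset.single_le_sum (f := φ.weight) (fun _ _ => Nat.zero_le _) (mem_leftEnds.mpr hv)
  classical
  -- Cut the cover just to the right of $v$. Summing the balancing condition over the vertices in
  -- `B` equates the weight leaving these vertices with the weight arriving at them. Every arriving
  -- edge is a left end or also leaves a vertex in `B`, and it is never `e`, whose target, if any,
  -- lies beyond $v$.
  let B : Finset φ.V := Finset.univ.filter fun u => φ.pos u ≤ φ.pos v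
  let Bs : Finset φ.E := B.biUnion φ.outEdges
  let Bt : Finset φ.E := B.biUnion φ.inEdges
  have hs : ∑ e ∈ Bs, φ.weight e = ∑ e ∈ Bt, φ.weight e := by
    rw [Finset.sum_biUnion, Finset.sum_biUnion]
    · exact Finset.sum_congr rfl fun u _ => (h.balanced u).symm
    · intro a _ b _ hab
      refine Finset.disjoint_left.mpr fun x hx hy => hab ?_
      rw [mem_inEdges] at hx hy
      simpa [hx] using hy
    · intro a _ b _ hab
      refine Finset.disjoint_left.mpr fun x hx hy => hab ?_
      rw [mem_outEdges] at hx hy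
      simpa [hx] using hy
  have mBs : ∀ {e}, e ∈ Bs ↔ ∃ u, φ.pos u ≤ φ.pos v ∧ φ.src e = some u := by
    intro e; simp [Bs, B, mem_outEdges]
  have mBt : ∀ {e}, e ∈ Bt ↔ ∃ u, φ.pos u ≤ φ.pos v ∧ φ.tgt e = some u := by
    intro e; simp [Bt, B, mem_inEdges]
  have hsub : Bt ⊆ (Bs.erase e) ∪ φ.leftEnds := by
    intro f hf
    obtain ⟨u, hu, hfu⟩ := mBt.mp hf
    rcases hw : φ.src f with _ | w
    · exact Finset.mem_union_right _ (mem_leftEnds.mpr hw)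
    · have hlt := h.increasing f w u hw hfu
      refine Finset.mem_union_left _ (Finset.mem_erase.mpr ⟨?_, mBs.mpr ⟨w, by linarith, hw⟩⟩)
      rintro rfl
      have : v = w := by simpa [hv] using hw
      subst this
      linarith
  have h1 : ∑ e ∈ Bt, φ.weight e ≤ ∑ e ∈ Bs.erase e, φ.weight e + ∑ e ∈ φ.leftEnds, φ.weight e :=
    (Finset.sum_le_sum_of_subset hsub).trans
      (by rw [← Finset.sum_union_inter]; exact Nat.le_add_right _ _)
  have h2 := Finset.add_sum_erase Bs φ.weight (mBs.mpr ⟨v, le_rfl, hv⟩)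
  omega

end IsTropicalCover

end CoverData

/-! ### Finiteness of the set of isomorphism classes -/

section Finiteness

variable {g s t : ℕ} {L R : Multiset ℕ} {z : BranchDistribution s t}

theorem BranchDistribution.finite_points (z : BranchDistribution s t) : z.points.Finite := by
  have : z.points ⊆ (Set.range (fun i => (z.x i).1) ∪ Set.range (fun i => (z.x i).2)) ∪
      Set.range z.y := by
    rintro r (⟨i, rfl | rfl⟩ | ⟨j, rfl⟩)
    · exact Or.inl (Or.inl ⟨i, rfl⟩)
    · exact Or.inl (Or.inr ⟨i, rfl⟩)
    · exact Or.inr ⟨j, rfl⟩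
  exact (((Set.finite_range _).union (Set.finite_range _)).union (Set.finite_range _)).subset this

/-- Type and distribution fix the numbers of vertices and edges, leave finitely many positions, and
bound the weights by the degree. After numbering vertices and edges, a cover is one of finitely many
codes, and equal codes give isomorphic covers. Without finiteness, comparisons of `Nat.card` and of
`finsum` would be meaningless. -/
instance finite_genZigzagClasses : Finite (GenZigzagClasses g L R z) := by
  classical
  let a := L.card + R.card + 2 * g - 2
  let b := 2 * L.card + 2 * R.card + 3 * g - 3
  have := z.finite_points.to_subtype
  let Code := (Fin b → Option (Fin a)) × (Fin b → Option (Fin a)) × (Fin a → z.points) ×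
    (Fin b → Fin (L.sum + 1))
  have hV (φ : GenZigzagCover g L R z) : Nonempty (φ.1.V ≃ Fin a) := by
    have := φ.2.cover.card_V
    exact ⟨Fintype.equivFinOfCardEq (by omega)⟩
  have hE (φ : GenZigzagCover g L R z) : Nonempty (φ.1.E ≃ Fin b) :=
    ⟨Fintype.equivFinOfCardEq φ.2.cover.card_E⟩
  let fV := fun φ => (hV φ).some
  let fE := fun φ => (hE φ).some
  let code : GenZigzagCover g L R z → Code := fun φ =>
    (fun i => (φ.1.src ((fE φ).symm i)).map (fV φ), fun i => (φ.1.tgt ((fE φ).symm i)).map (fV φ),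
      fun i => ⟨φ.1.pos ((fV φ).symm i), φ.2.cover.pos_mem _⟩,
      fun i => ⟨φ.1.weight ((fE φ).symm i), Nat.lt_succ_of_le (φ.2.cover.weight_le _)⟩)
  have hcode (φ ψ : GenZigzagCover g L R z) (h : code φ = code ψ) :
      Nonempty (CoverData.Iso φ.1 ψ.1) := by
    have h1 i := congrFun (congrArg (fun c : Code => c.1) h) i
    have h2 i := congrFun (congrArg (fun c : Code => c.2.1) h) i
    have h3 i := congrArg Subtype.val (congrFun (congrArg (fun c : Code => c.2.2.1) h) i)
    have h4 i := congrArg Fin.val (congrFun (congrArg (fun c : Code => c.2.2.2) h) i)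
    simp only [code] at h1 h2 h3 h4
    refine ⟨⟨(fV φ).trans (fV ψ).symm, (fE φ).trans (fE ψ).symm, fun e => ?_, fun e => ?_,
      fun v => ?_, fun e => ?_⟩⟩
    · have := congrArg (Option.map (fV ψ).symm) (h1 (fE φ e))
      simp only [Option.map_map, Equiv.symm_comp_self, Option.map_id, Equiv.symm_apply_apply] at this
      exact this.symm
    · have := congrArg (Option.map (fV ψ).symm) (h2 (fE φ e))
      simp only [Option.map_map, Equiv.symm_comp_self, Option.map_id, Equiv.symm_apply_apply] at this
      exact this.symm
    · simpa using (h3 (fV φ v)).symm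
    · simpa using (h4 (fE φ e)).symm
  refine Finite.of_injective (fun c : GenZigzagClasses g L R z => code (Quotient.out c))
    fun c c' h => ?_
  rw [← Quotient.out_eq c, ← Quotient.out_eq c']
  exact Quotient.sound (hcode _ _ h)

end Finiteness

/-! ### Zigzag covers with only triple branch points -/

namespace CoverData

variable {φ : CoverData} {g s : ℕ} {L R : Multiset ℕ} {z : BranchDistribution s 0}

theorem IsResolvingPair.exists_edge {v₁ v₂ : φ.V} (h : φ.IsResolvingPair v₁ v₂) :
    ∃ c, φ.src c = some v₁ ∧ φ.tgt c = some v₂ := by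
  rcases h with ⟨a, b, c, d, f, -, h1, h2, -, -⟩ | ⟨a, b, c, d, f, -, h2, h1, -, -⟩ |
    ⟨a, b, c, d, f, -, h1, h2, -, -⟩ | ⟨a, b, c, f, -, h1, h2, -, -⟩
  all_goals exact ⟨c, mem_outEdges.mp (by simp [h1]), mem_inEdges.mp (by simp [h2])⟩

/-- Every inner vertex is incident to a contractible edge. -/
theorem exists_contractible (h : φ.IsTropicalCover g L R z) (hr : φ.IsResolving z)
    (hp : Function.Injective φ.pos) (v : φ.V) : ∃ c, φ.IsContractible z c ∧ φ.Inc c v := by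
  have hv := h.pos_mem v
  rw [z.points_eq_range] at hv
  obtain ⟨⟨i, b⟩, hi⟩ := hv
  obtain ⟨v₁, v₂, h1, h2, h3⟩ := hr i
  obtain ⟨c, hc1, hc2⟩ := h3.exists_edge
  refine ⟨c, ⟨i, v₁, v₂, h1, h2, hc1, hc2⟩, ?_⟩
  cases b
  · exact Or.inl (hp (h1.trans hi) ▸ hc1)
  · exact Or.inr (hp (h2.trans hi) ▸ hc2)

theorem cellGraph_adj {v : φ.V} {e : φ.E} : φ.cellGraph.Adj (Sum.inl v) (Sum.inr e) ↔ φ.Inc e v := by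
  simp [cellGraph]

theorem cellGraph_adj' {v : φ.V} {e : φ.E} : φ.cellGraph.Adj (Sum.inr e) (Sum.inl v) ↔ φ.Inc e v := by
  simp [cellGraph]

theorem not_cellGraph_adj_inl (v w : φ.V) : ¬ φ.cellGraph.Adj (Sum.inl v) (Sum.inl w) := by
  simp [cellGraph]

theorem not_cellGraph_adj_inr (e f : φ.E) : ¬ φ.cellGraph.Adj (Sum.inr e) (Sum.inr f) := by
  simp [cellGraph]

theorem exists_inc (h : φ.cellGraph.Connected) (v : φ.V) (e : φ.E) : ∃ u, φ.Inc e u := by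
  have : Nontrivial (φ.V ⊕ φ.E) := ⟨Sum.inl v, Sum.inr e, by simp⟩
  obtain ⟨x, hx⟩ := h.preconnected.exists_adj_of_nontrivial (Sum.inr e)
  rcases x with u | f
  · exact ⟨u, cellGraph_adj'.mp hx⟩
  · exact absurd hx (not_cellGraph_adj_inr _ _)

theorem IsEnd.inc_unique {e : φ.E} (he : φ.IsEnd e) {u v : φ.V} (hu : φ.Inc e u) (hv : φ.Inc e v) :
    u = v := by
  rcases he with he | he <;> rcases hu with hu | hu <;> rcases hv with hv | hv <;> simp_all

/-- When there are only triple branch points, a generalized zigzag cover is a resolving cover all of whose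
even inner edges are contractible. -/
theorem isGenZigzag_iff (hs : 2 * s + 2 = L.card + R.card + 2 * g) (hs0 : 0 < s) :
    φ.IsGenZigzag g L R z ↔ φ.IsTropicalCover g L R z ∧ φ.IsResolving z ∧
      ∀ e, ¬ φ.IsEnd e → Even (φ.weight e) → φ.IsContractible z e := by
  constructor
  · rintro ⟨hc, hr, S, hS⟩
    refine ⟨hc, hr, fun e he hev => ?_⟩
    -- A core contains all contractible edges together with their vertices, hence every inner
    -- vertex. Components of the complement then contain no vertex, which excludes every kind of
    -- tail except a single end.
    have hV (v : φ.V) : Sum.inl v ∈ S := by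
      obtain ⟨c, hc1, hc2⟩ := exists_contractible hc hr (hc.pos_injective hs) v
      exact hS.closed c v (hS.contractible_mem c hc1) hc2
    by_cases heS : Sum.inr e ∈ S
    · exact hS.even_contractible e heS hev
    exfalso
    let x : (Sᶜ : Set (φ.V ⊕ φ.E)) := ⟨Sum.inr e, heS⟩
    obtain ⟨u, f, hu, hK⟩ := hS.tails ((φ.cellGraph.induce Sᶜ).connectedComponentMk x)
    have hx : Sum.inr e ∈ (Subtype.val '' ((φ.cellGraph.induce Sᶜ).connectedComponentMk x).supp) :=
      ⟨x, SimpleGraph.ConnectedComponent.connectedComponentMk_mem, rfl⟩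
    have hno (v : φ.V) : Sum.inl v ∉ (Subtype.val ''
        ((φ.cellGraph.induce Sᶜ).connectedComponentMk x).supp) := by
      rintro ⟨y, -, hy⟩
      exact y.2 (hy ▸ hV v)
    generalize (Subtype.val '' ((φ.cellGraph.induce Sᶜ).connectedComponentMk x).supp) = K at *
    cases hK with
    | leaf _ _ _ hend _ =>
      obtain rfl : e = f := by simpa using hx
      exact he hend
    | fork _ v => exact hno v (by simp)
    | cycle _ v => exact hno v (by simp)
  · rintro ⟨hc, hr, hev⟩
    -- The core is obtained by removing exactly the even ends.
    refine ⟨hc, hr, {x | ∀ e, x = Sum.inr e → ¬ (φ.IsEnd e ∧ Even (φ.weight e))}, ?_⟩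
    set S : Set (φ.V ⊕ φ.E) := {x | ∀ e, x = Sum.inr e → ¬ (φ.IsEnd e ∧ Even (φ.weight e))} with hS
    have hV (v : φ.V) : Sum.inl v ∈ S := by simp [hS]
    have hE (e : φ.E) : Sum.inr e ∈ S ↔ ¬ (φ.IsEnd e ∧ Even (φ.weight e)) := by simp [hS]
    have hpos := hc.pos_injective hs
    obtain ⟨v₀⟩ : Nonempty φ.V := ⟨(hr ⟨0, hs0⟩).choose⟩
    refine ⟨fun e v _ _ => hV v, ?_, ?_, ?_, ⟨v₀, hV v₀⟩, ?_, ?_⟩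
    -- Connectedness survives the removal because a removed end has only one vertex. Along a path,
    -- the invariant attached to a removed cell is that it is adjacent to a vertex already reached
    -- inside `S`; the path must return to that same vertex.
    · have key (x : φ.V ⊕ φ.E) : (∀ hx : x ∈ S, (φ.cellGraph.induce S).Reachable ⟨_, hV v₀⟩ ⟨x, hx⟩) ∧
          (x ∉ S → ∃ v, φ.cellGraph.Adj x (Sum.inl v) ∧
            (φ.cellGraph.induce S).Reachable ⟨_, hV v₀⟩ ⟨_, hV v⟩) := by
        have hreach := (SimpleGraph.reachable_iff_reflTransGen _ _).mp (hc.connected.preconnected (Sum.inl v₀) x)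
        induction hreach with
        | refl => exact ⟨fun _ => SimpleGraph.Reachable.refl _, fun h => absurd (hV v₀) h⟩
        | @tail y x _ hadj ih =>
          by_cases hy : y ∈ S
          · refine ⟨fun hx => (ih.1 hy).trans (SimpleGraph.Adj.reachable hadj), fun hx => ?_⟩
            rcases x with v | e
            · exact absurd (hV v) hx
            rcases y with v | e'
            · exact ⟨v, hadj.symm, ih.1 hy⟩
            · exact absurd hadj (not_cellGraph_adj_inr _ _)
          · obtain ⟨u, hu1, hu2⟩ := ih.2 hy
            rcases y with v | e
            · exact absurd (hV v) hy
            rcases x with v | e'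
            · rw [hE, not_not] at hy
              obtain rfl := hy.1.inc_unique (cellGraph_adj'.mp hu1) (cellGraph_adj'.mp hadj)
              exact ⟨fun _ => hu2, fun h => absurd (hV u) h⟩
            · exact absurd hadj (not_cellGraph_adj_inr _ _)
      have : Nonempty S := ⟨⟨_, hV v₀⟩⟩
      exact ⟨fun x y => ((key x).1 x.2).symm.trans ((key y).1 y.2)⟩
    -- There is nothing in `Sym₂`: every edge has an inner vertex, and every inner vertex lies on a
    -- contractible edge.
    · rintro p ⟨hp1, hp2, hp3⟩ e hep
      refine absurd ?_ hp3
      obtain ⟨v, hv⟩ := exists_inc hc.connected v₀ e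
      obtain ⟨c, hc1, hc2⟩ := exists_contractible hc hr hpos v
      exact ⟨c, hc1, e, hep, v, hc2, hv⟩
    · rintro e ⟨i, v₁, v₂, -, -, h1, h2⟩
      rw [hE]
      rintro ⟨he | he, -⟩ <;> simp_all
    · intro e he hee
      exact hev e (fun h => (hE e).mp he ⟨h, hee⟩) hee
    · intro K
      obtain ⟨⟨x, hx⟩, rfl⟩ := K.exists_rep
      rcases x with v | e
      · exact absurd (hV v) hx
      obtain ⟨u, hu⟩ := exists_inc hc.connected v₀ e
      have he := not_not.mp ((hE e).not.mp hx)
      refine ⟨u, e, hV u, ?_⟩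
      -- The complement of `S` consists of edges only, so no two of its cells are adjacent and each
      -- component is a single even end.
      have hnoadj (a b : (Sᶜ : Set (φ.V ⊕ φ.E))) : ¬ (φ.cellGraph.induce Sᶜ).Adj a b := by
        rcases a with ⟨v | f, ha⟩
        · exact absurd (hV v) ha
        rcases b with ⟨v | f', hb⟩
        · exact absurd (hV v) hb
        exact not_cellGraph_adj_inr _ _
      convert IsTail.leaf u e hu he.1 he.2
      ext y
      simp only [Set.mem_image, Set.mem_singleton_iff]
      constructor
      · rintro ⟨y, hy, rfl⟩
        have hr := SimpleGraph.ConnectedComponent.exact (SimpleGraph.ConnectedComponent.mem_supp_iff _ _ |>.mp hy)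
        rw [SimpleGraph.reachable_iff_reflTransGen] at hr
        rcases Relation.ReflTransGen.cases_head hr with h | ⟨w, hw, -⟩
        · rw [h]
        · exact absurd hw (hnoadj _ _)
      · rintro rfl
        exact ⟨⟨_, hx⟩, SimpleGraph.ConnectedComponent.connectedComponentMk_mem, rfl⟩

/-! ### Independence of the distribution -/

/-- Move the inner vertices of a cover. -/
def relabel (φ : CoverData) (r : ℝ → ℝ) : CoverData := { φ with pos := fun v => r (φ.pos v) }

theorem IsResolvingPair.relabel {v₁ v₂ : φ.V} (h : φ.IsResolvingPair v₁ v₂) (r : ℝ → ℝ) :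
    (φ.relabel r).IsResolvingPair v₁ v₂ := by
  rcases h with ⟨a, b, c, d, f, h1, h2, h3, h4, h5⟩ | ⟨a, b, c, d, f, h1, h2, h3, h4, h5⟩ |
    ⟨a, b, c, d, f, h1, h2, h3, h4, h5⟩ | ⟨a, b, c, f, h1, h2, h3, h4, h5⟩
  · exact .mergeMerge a b c d f h1 h2 h3 h4 h5
  · exact .splitSplit a b c d f h1 h2 h3 h4 h5
  · exact .splitMerge a b c d f h1 h2 h3 h4 h5
  · exact .cycle a b c f h1 h2 h3 h4 h5

/-- The conditions involve the points only through their order and their grouping into pairs, which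
are the same for any two distributions with $s$ pairs. -/
theorem IsGenZigzag.relabel (h : φ.IsGenZigzag g L R z) (z' : BranchDistribution s 0)
    (hs : 2 * s + 2 = L.card + R.card + 2 * g) (hs0 : 0 < s) {r : ℝ → ℝ}
    (hr : ∀ i, r (z.pt i) = z'.pt i) : (φ.relabel r).IsGenZigzag g L R z' := by
  rw [isGenZigzag_iff hs hs0] at h ⊢
  obtain ⟨hc, hres, hev⟩ := h
  have hpt (v : φ.V) : ∃ i b, φ.pos v = z.pt (i, b) ∧ (φ.relabel r).pos v = z'.pt (i, b) := by
    have hv := hc.pos_mem v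
    rw [z.points_eq_range] at hv
    obtain ⟨⟨i, b⟩, hi⟩ := hv
    exact ⟨i, b, hi.symm, by simp only [CoverData.relabel, ← hi, hr]⟩
  have hr1 (i) : r (z.x i).1 = (z'.x i).1 := hr (i, false)
  have hr2 (i) : r (z.x i).2 = (z'.x i).2 := hr (i, true)
  refine ⟨⟨fun e v w h1 h2 => ?_, hc.weight_pos, hc.trivalent, hc.connected, hc.genus, ?_,
    hc.balanced, hc.left_profile, hc.right_profile⟩, fun i => ?_, fun e he hw => ?_⟩
  · have := hc.increasing e v w h1 h2
    obtain ⟨i, b, hi, hi'⟩ := hpt v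
    obtain ⟨j, c, hj, hj'⟩ := hpt w
    rw [hi, hj, z.pt_lt_iff] at this
    rwa [hi', hj', z'.pt_lt_iff]
  · change Set.range (r ∘ φ.pos) = _
    rw [Set.range_comp, hc.image, z.points_eq_range, z'.points_eq_range, ← Set.range_comp]
    congr 1
    exact funext hr
  · obtain ⟨v₁, v₂, h1, h2, h3⟩ := hres i
    exact ⟨v₁, v₂, by simp only [CoverData.relabel, h1, hr1], by simp only [CoverData.relabel, h2, hr2],
      h3.relabel r⟩
  · obtain ⟨i, v₁, v₂, h1, h2, h3⟩ := hev e he hw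
    exact ⟨i, v₁, v₂, by simp only [CoverData.relabel, h1, hr1],
      by simp only [CoverData.relabel, h2, hr2], h3⟩

end CoverData

/-- A family of covers indexed by isomorphism classes of other covers bounds the number of classes. -/
theorem card_genZigzagClasses_le {g s g' s' : ℕ} {L R L' R' : Multiset ℕ}
    {z : BranchDistribution s 0} {z' : BranchDistribution s' 0}
    (f : GenZigzagCover g L R z → GenZigzagCover g' L' R' z')
    (hf : ∀ φ ψ, Nonempty (CoverData.Iso (f φ).1 (f ψ).1) → Nonempty (CoverData.Iso φ.1 ψ.1)) :
    Nat.card (GenZigzagClasses g L R z) ≤ Nat.card (GenZigzagClasses g' L' R' z') := by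
  refine Nat.card_le_card_of_injective (fun c => Quotient.mk _ (f (Quotient.out c))) fun c c' h => ?_
  rw [← Quotient.out_eq c, ← Quotient.out_eq c']
  exact Quotient.sound (hf _ _ (Quotient.exact h))

/-- The number of classes of covers does not depend on the distribution. -/
theorem card_genZigzagClasses_le_of_distribution {g s : ℕ} {L R : Multiset ℕ}
    (z z' : BranchDistribution s 0) (hs : 2 * s + 2 = L.card + R.card + 2 * g) (hs0 : 0 < s) :
    Nat.card (GenZigzagClasses g L R z) ≤ Nat.card (GenZigzagClasses g L R z') := by
  -- Only the values of `r` at the points of `z` matter; the default value elsewhere plays no role.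
  let r : ℝ → ℝ := Function.extend z.pt z'.pt 0
  have hr (i) : r (z.pt i) = z'.pt i := z.pt_injective.extend_apply _ _ _
  refine card_genZigzagClasses_le (fun φ => ⟨φ.1.relabel r, φ.2.relabel z' hs hs0 hr⟩) ?_
  rintro φ ψ ⟨f⟩
  refine ⟨⟨f.onV, f.onE, f.src_eq, f.tgt_eq, fun v => ?_, f.weight_eq⟩⟩
  have h := f.pos_eq v
  have h1 := φ.2.cover.pos_mem v
  have h2 := ψ.2.cover.pos_mem (f.onV v)
  rw [z.points_eq_range] at h1 h2
  obtain ⟨i, hi⟩ := h1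
  obtain ⟨j, hj⟩ := h2
  change r (ψ.1.pos (f.onV v)) = r (φ.1.pos v) at h
  rw [← hi, ← hj, hr, hr] at h
  rw [z'.pt_injective h] at hj
  exact hj.symm.trans hi

/-! ### Gluing a pair of vertices to an end -/

/-- The distribution with the pairs `(0, 1), (2, 3), …`. -/
noncomputable def stdDistribution (n : ℕ) : BranchDistribution n 0 where
  x i := (2 * (i : ℕ), 2 * (i : ℕ) + 1)
  y := Fin.elim0
  fst_lt_snd i := by simp
  snd_lt_fst i j h := by
    have : ((i : ℕ) : ℝ) + 1 ≤ (j : ℕ) := by exact_mod_cast h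
    simp only
    linarith
  y_strictMono i := i.elim0
  y_notMem _ j := j.elim0

theorem mem_points_stdDistribution {n : ℕ} {r : ℝ} :
    r ∈ (stdDistribution n).points ↔ ∃ i < n, r = 2 * (i : ℝ) ∨ r = 2 * (i : ℝ) + 1 := by
  simp [BranchDistribution.points, stdDistribution, Fin.exists_iff]

theorem lt_of_mem_points_stdDistribution {n : ℕ} {r : ℝ} (h : r ∈ (stdDistribution n).points) :
    r < 2 * (n : ℝ) := by
  obtain ⟨i, hi, hr⟩ := mem_points_stdDistribution.mp h
  have : (i : ℝ) + 1 ≤ n := by exact_mod_cast hi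
  rcases hr with rfl | rfl <;> linarith

theorem points_stdDistribution_succ (n : ℕ) :
    (stdDistribution (n + 1)).points = (stdDistribution n).points ∪ {2 * (n : ℝ), 2 * (n : ℝ) + 1} := by
  ext r
  simp only [mem_points_stdDistribution, Set.mem_union, Set.mem_insert_iff, Set.mem_singleton_iff,
    Nat.lt_succ_iff_lt_or_eq, or_and_right, exists_or, exists_eq_left]

/-- A piece of a cover with a pair of inner vertices `false`, `true`. It is glued to a cover along an end, which
becomes an edge arriving at `att`. -/
structure Gadget where
  n : ℕ
  src : Fin n → Option Bool
  tgt : Fin n → Option Bool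
  weight : Fin n → ℕ
  att : Bool

/-- Gluing the gadget to an end of weight `p` changes the cover as follows: the end `out` of weight `p'`
replaces the end of weight `p`, further ends of weights `L` and `R` are added, and the genus increases by
`γ`. -/
structure Gadget.IsValid (G : Gadget) (p p' : ℕ) (L R : Multiset ℕ) (γ : ℕ) (out : Fin G.n) :
    Prop where
  increasing : ∀ i b c, G.src i = some b → G.tgt i = some c → b = false ∧ c = true
  link : ∃ i, G.src i = some false ∧ G.tgt i = some true
  inc : ∀ i, ∃ b, G.src i = some b ∨ G.tgt i = some b
  weight_pos : ∀ i, 0 < G.weight i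
  trivalent : ∀ b, (if b = G.att then 1 else 0) + (Finset.univ.filter fun i => G.tgt i = some b).card
    + (Finset.univ.filter fun i => G.src i = some b).card = 3
  balanced : ∀ b, (if b = G.att then p else 0)
    + ∑ i ∈ Finset.univ.filter (fun i => G.tgt i = some b), G.weight i
    = ∑ i ∈ Finset.univ.filter (fun i => G.src i = some b), G.weight i
  left_profile : (Finset.univ.filter fun i => G.src i = none).val.map G.weight = L
  right_profile : (Finset.univ.filter fun i => G.tgt i = none).val.map G.weight = p' ::ₘ R
  genus : G.n = 2 + L.card + R.card + γ
  card_eq : 2 = L.card + R.card + 2 * γ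
  out_tgt : G.tgt out = none
  out_free : ∀ i, i ≠ out → G.tgt i = none → G.src i ≠ G.src out
  out_src : G.src out ≠ none
  out_weight : G.weight out = p'

namespace CoverData

/-- `a` is an end towards `+∞` that shares its inner vertex with no other end towards `+∞`. -/
def IsFreeEnd (φ : CoverData) (a : φ.E) : Prop :=
  φ.tgt a = none ∧ ∀ e, e ≠ a → φ.tgt e = none → φ.src e ≠ φ.src a

/-- Glue a gadget with its vertices at `2n` and `2n+1` to the end `a`. -/
noncomputable abbrev glue (φ : CoverData) (a : φ.E) (G : Gadget) (n : ℕ) : CoverData where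
  V := φ.V ⊕ Bool
  E := φ.E ⊕ Fin G.n
  src := Sum.elim (fun e => (φ.src e).map Sum.inl) (fun i => (G.src i).map Sum.inr)
  tgt := Sum.elim (fun e => if e = a then some (Sum.inr G.att) else (φ.tgt e).map Sum.inl)
    (fun i => (G.tgt i).map Sum.inr)
  pos := Sum.elim φ.pos (fun b => if b then 2 * (n : ℝ) + 1 else 2 * (n : ℝ))
  weight := Sum.elim φ.weight G.weight

section Glue

variable (φ : CoverData) (a : φ.E) (G : Gadget) (n : ℕ)

theorem glue_outEdges_inl (v : φ.V) :
    (φ.glue a G n).outEdges (Sum.inl v) = (φ.outEdges v).disjSum ∅ := by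
  ext x
  rw [mem_outEdges]
  rcases x with e | i <;> simp [mem_outEdges]

theorem glue_outEdges_inr (b : Bool) : (φ.glue a G n).outEdges (Sum.inr b) =
    (∅ : Finset φ.E).disjSum (Finset.univ.filter fun i => G.src i = some b) := by
  ext x
  rw [mem_outEdges]
  rcases x with e | i <;> simp

theorem glue_inEdges_inl (ha : φ.tgt a = none) (v : φ.V) :
    (φ.glue a G n).inEdges (Sum.inl v) = (φ.inEdges v).disjSum ∅ := by
  ext x
  rw [mem_inEdges]
  rcases x with e | i
  · by_cases h : e = a
    · simp [h, mem_inEdges, ha]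
    · simp [h, mem_inEdges]
  · simp

theorem glue_inEdges_inr (b : Bool) : (φ.glue a G n).inEdges (Sum.inr b) =
    (if b = G.att then {a} else ∅ : Finset φ.E).disjSum
      (Finset.univ.filter fun i => G.tgt i = some b) := by
  ext x
  rw [mem_inEdges]
  rcases x with e | i
  · rcases eq_or_ne b G.att with hb | hb
    · by_cases h : e = a <;> simp [h, hb.symm]
    · by_cases h : e = a <;> simp [h, hb, hb.symm]
  · simp

theorem glue_leftEnds : (φ.glue a G n).leftEnds =
    φ.leftEnds.disjSum (Finset.univ.filter fun i => G.src i = none) := by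
  ext x
  rw [mem_leftEnds]
  rcases x with e | i <;> simp [mem_leftEnds]

theorem glue_rightEnds : (φ.glue a G n).rightEnds =
    (φ.rightEnds.erase a).disjSum (Finset.univ.filter fun i => G.tgt i = none) := by
  ext x
  rw [mem_rightEnds]
  rcases x with e | i
  · by_cases h : e = a <;> simp [h, mem_rightEnds]
  · simp

variable {φ a G n}

theorem Inc.glue {e : φ.E} {v : φ.V} (h : φ.Inc e v) (ha : φ.tgt a = none) :
    (φ.glue a G n).Inc (Sum.inl e) (Sum.inl v) := by
  rcases h with h | h
  · exact Or.inl (by simp [h])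
  · refine Or.inr ?_
    have : e ≠ a := by rintro rfl; simp [ha] at h
    simp [h, this]

theorem IsSymCycle.glue (ha : φ.tgt a = none) {b c : φ.E} (h : φ.IsSymCycle {b, c}) :
    (φ.glue a G n).IsSymCycle {Sum.inl b, Sum.inl c} := by
  obtain ⟨e₁, e₂, v, w, h1, h2, h3, h4, h5, h6, h7⟩ := h
  have h8 : e₁ ≠ a := by rintro rfl; simp [ha] at h6
  have h9 : e₂ ≠ a := by rintro rfl; simp [ha] at h7
  refine ⟨Sum.inl e₁, Sum.inl e₂, Sum.inl v, Sum.inl w, by simpa, ?_, h3, by simp [h4], by simp [h5],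
    by simp [h6, h8], by simp [h7, h9]⟩
  have := congrArg (Finset.map Function.Embedding.inl (β := φ.E ⊕ Fin G.n)) h2
  simpa using this

theorem IsSymFork.glue (ha : φ.tgt a = none) {b c : φ.E} (hb : b ≠ a) (hc : c ≠ a)
    (h : φ.IsSymFork {b, c}) : (φ.glue a G n).IsSymFork {Sum.inl b, Sum.inl c} := by
  obtain ⟨e₁, e₂, v, h1, h2, h3, h4, h5, h6, h7⟩ := h
  have h8 : e₁ ∈ ({b, c} : Finset φ.E) := by simp [h2]
  have h9 : e₂ ∈ ({b, c} : Finset φ.E) := by simp [h2]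
  replace h8 : e₁ ≠ a := by rintro rfl; simp [hb.symm, hc.symm] at h8
  replace h9 : e₂ ≠ a := by rintro rfl; simp [hb.symm, hc.symm] at h9
  refine ⟨Sum.inl e₁, Sum.inl e₂, Sum.inl v, by simpa, ?_, h3, ?_, ?_, h6.glue ha, h7.glue ha⟩
  · have := congrArg (Finset.map Function.Embedding.inl (β := φ.E ⊕ Fin G.n)) h2
    simpa using this
  · exact h4.imp (by simp +contextual) (by simp +contextual [h8])
  · exact h5.imp (by simp +contextual) (by simp +contextual [h9])

/-- Both edges arrive at an inner vertex, so neither is the end `a`; freeness is not needed on this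
side. -/
theorem IsSym.glue_of_inEdges (ha : φ.tgt a = none) {b c : φ.E} {v : φ.V}
    (hv : φ.inEdges v = {b, c}) (h : φ.IsSym {b, c}) :
    (φ.glue a G n).IsSym {Sum.inl b, Sum.inl c} := by
  have hb : φ.tgt b = some v := mem_inEdges.mp (by simp [hv])
  have hc : φ.tgt c = some v := mem_inEdges.mp (by simp [hv])
  refine h.imp (IsSymCycle.glue ha) (IsSymFork.glue ha ?_ ?_) <;> rintro rfl <;> simp_all

/-- This is where freeness is needed. If `a` belonged to a symmetric fork of outgoing edges, the
other prong would be a second end towards $+\infty$ at the same vertex. -/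
theorem IsSym.glue_of_outEdges (ha : φ.IsFreeEnd a) {b c : φ.E} {v : φ.V}
    (hv : φ.outEdges v = {b, c}) (h : φ.IsSym {b, c}) :
    (φ.glue a G n).IsSym {Sum.inl b, Sum.inl c} := by
  have hb : φ.src b = some v := mem_outEdges.mp (by simp [hv])
  have hc : φ.src c = some v := mem_outEdges.mp (by simp [hv])
  refine h.imp (IsSymCycle.glue ha.1) fun hf => ?_
  obtain ⟨e₁, e₂, u, h1, h2, -, h4, h5, -, -⟩ := id hf
  have key : ∀ e ∈ ({b, c} : Finset φ.E), φ.src e = some v ∧ φ.tgt e = none := by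
    have hs : ∀ e ∈ ({b, c} : Finset φ.E), φ.src e = some v := fun e he =>
      mem_outEdges.mp (hv ▸ he)
    intro e he
    refine ⟨hs e he, ?_⟩
    have he' := he
    rw [h2, Finset.mem_insert, Finset.mem_singleton] at he
    rcases he with rfl | rfl
    · exact h4.resolve_left (by simp [hs _ he'])
    · exact h5.resolve_left (by simp [hs _ he'])
  have hbc : b ≠ c := by
    rintro rfl
    have := congrArg Finset.card h2
    rw [Finset.card_pair h1] at this
    simp at this
  refine IsSymFork.glue ha.1 ?_ ?_ hf
  · rintro rfl
    exact ha.2 c hbc.symm (key c (by simp)).2 (by rw [hb, hc])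
  · rintro rfl
    exact ha.2 b hbc (key b (by simp)).2 (by rw [hb, hc])

theorem IsResolvingPair.glue (ha : φ.IsFreeEnd a) {v₁ v₂ : φ.V} (h : φ.IsResolvingPair v₁ v₂) :
    (φ.glue a G n).IsResolvingPair (Sum.inl v₁) (Sum.inl v₂) := by
  have e1 (b : φ.E) : ({b} : Finset φ.E).disjSum (∅ : Finset (Fin G.n)) = {Sum.inl b} := by simp
  have e2 (b c : φ.E) : ({b, c} : Finset φ.E).disjSum (∅ : Finset (Fin G.n)) = {Sum.inl b, Sum.inl c} := by
    simp
  rcases h with ⟨b, c, d, e, f, h1, h2, h3, h4, h5⟩ | ⟨b, c, d, e, f, h1, h2, h3, h4, h5⟩ |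
    ⟨b, c, d, e, f, h1, h2, h3, h4, h5⟩ | ⟨b, c, d, f, h1, h2, h3, h4, h5⟩
  · refine .mergeMerge (Sum.inl b) (Sum.inl c) (Sum.inl d) (Sum.inl e) (Sum.inl f) ?_ ?_ ?_ ?_
      (h5.glue_of_inEdges ha.1 h1)
    · rw [glue_inEdges_inl _ _ _ _ ha.1, h1]; exact e2 _ _
    · rw [glue_outEdges_inl, h2]; exact e1 _
    · rw [glue_inEdges_inl _ _ _ _ ha.1, h3]; exact e2 _ _
    · rw [glue_outEdges_inl, h4]; exact e1 _
  · refine .splitSplit (Sum.inl b) (Sum.inl c) (Sum.inl d) (Sum.inl e) (Sum.inl f) ?_ ?_ ?_ ?_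
      (h5.glue_of_outEdges ha h1)
    · rw [glue_outEdges_inl, h1]; exact e2 _ _
    · rw [glue_inEdges_inl _ _ _ _ ha.1, h2]; exact e1 _
    · rw [glue_outEdges_inl, h3]; exact e2 _ _
    · rw [glue_inEdges_inl _ _ _ _ ha.1, h4]; exact e1 _
  · refine .splitMerge (Sum.inl b) (Sum.inl c) (Sum.inl d) (Sum.inl e) (Sum.inl f) ?_ ?_ ?_ ?_
      (Sum.inl_injective.ne h5)
    · rw [glue_inEdges_inl _ _ _ _ ha.1, h1]; exact e1 _
    · rw [glue_outEdges_inl, h2]; exact e2 _ _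
    · rw [glue_inEdges_inl _ _ _ _ ha.1, h3]; exact e2 _ _
    · rw [glue_outEdges_inl, h4]; exact e1 _
  · refine .cycle (Sum.inl b) (Sum.inl c) (Sum.inl d) (Sum.inl f) ?_ ?_ ?_ ?_ h5
    · rw [glue_inEdges_inl _ _ _ _ ha.1, h1]; exact e1 _
    · rw [glue_outEdges_inl, h2]; exact e2 _ _
    · rw [glue_inEdges_inl _ _ _ _ ha.1, h3]; exact e2 _ _
    · rw [glue_outEdges_inl, h4]; exact e1 _

end Glue

/-- A generalized zigzag cover with a distinguished free end `a` of odd weight `p`; the other ends towards `+∞`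
have weights `R`. -/
structure IsPointed (φ : CoverData) (a : φ.E) (g n p : ℕ) (L R : Multiset ℕ) : Prop where
  cover : φ.IsTropicalCover g L (p ::ₘ R) (stdDistribution n)
  resolving : φ.IsResolving (stdDistribution n)
  even_contractible : ∀ e, ¬ φ.IsEnd e → Even (φ.weight e) → φ.IsContractible (stdDistribution n) e
  free : φ.IsFreeEnd a
  weight_eq : φ.weight a = p
  odd : Odd p

theorem glue_connected {φ : CoverData} {a : φ.E} {G : Gadget} {n p p' γ : ℕ} {L' R' : Multiset ℕ}
    {out : Fin G.n} (h : φ.cellGraph.Connected) (ha : φ.tgt a = none)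
    (hG : G.IsValid p p' L' R' γ out) : (φ.glue a G n).cellGraph.Connected := by
  have hold (x : φ.V ⊕ φ.E) :
      (φ.glue a G n).cellGraph.Reachable (Sum.inr (Sum.inl a)) (Sum.map Sum.inl Sum.inl x) := by
    let f : φ.cellGraph →g (φ.glue a G n).cellGraph :=
      { toFun := Sum.map Sum.inl Sum.inl
        map_rel' := by
          rintro (v | e) (w | f) hadj
          · exact absurd hadj (not_cellGraph_adj_inl _ _)
          · exact cellGraph_adj.mpr ((cellGraph_adj.mp hadj).glue ha)
          · exact cellGraph_adj'.mpr ((cellGraph_adj'.mp hadj).glue ha)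
          · exact absurd hadj (not_cellGraph_adj_inr _ _) }
    exact (h.preconnected (Sum.inr a) x).map f
  obtain ⟨i, hi1, hi2⟩ := hG.link
  have hatt : (φ.glue a G n).cellGraph.Reachable (Sum.inr (Sum.inl a)) (Sum.inl (Sum.inr G.att)) :=
    (cellGraph_adj'.mpr (Or.inr (by simp))).reachable
  have hft : (φ.glue a G n).cellGraph.Reachable (Sum.inl (Sum.inr false)) (Sum.inl (Sum.inr true)) :=
    (cellGraph_adj (e := (Sum.inr i : φ.E ⊕ Fin G.n)).mpr (Or.inl (by simp [hi1]))).reachable.trans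
      (cellGraph_adj'.mpr (Or.inr (by simp [hi2]))).reachable
  have hnew (b : Bool) :
      (φ.glue a G n).cellGraph.Reachable (Sum.inr (Sum.inl a)) (Sum.inl (Sum.inr b)) := by
    generalize G.att = c at hatt
    cases b <;> cases c
    exacts [hatt, hatt.trans hft.symm, hatt.trans hft, hatt]
  have key (x : (φ.V ⊕ Bool) ⊕ (φ.E ⊕ Fin G.n)) :
      (φ.glue a G n).cellGraph.Reachable (Sum.inr (Sum.inl a)) x := by
    rcases x with (v | b) | (e | j)
    · exact hold (Sum.inl v)
    · exact hnew b
    · exact hold (Sum.inr e)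
    · obtain ⟨b, hb⟩ := hG.inc j
      refine (hnew b).trans (cellGraph_adj.mpr ?_).reachable
      exact hb.imp (by simp +contextual) (by simp +contextual)
  have : Nonempty ((φ.glue a G n).V ⊕ (φ.glue a G n).E) := ⟨Sum.inr (Sum.inl a)⟩
  exact ⟨fun x y => (key x).symm.trans (key y)⟩

/-- Old pairs keep their local pictures because `a` is free, and the new pair is admissible by
`hres`. The even inner edges remain contractible: `a` has odd weight, and an inner edge of the
gadget runs from its first vertex to its second. The end `out` is free by `out_free`, since the
remaining old ends do not start at vertices of the gadget. -/
theorem IsPointed.glue {φ : CoverData} {a : φ.E} {G : Gadget} {g n p p' γ : ℕ} {L R L' R' : Multiset ℕ}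
    {out : Fin G.n} (h : φ.IsPointed a g n p L R) (hG : G.IsValid p p' L' R' γ out) (hp' : Odd p')
    (hres : (φ.glue a G n).IsResolvingPair (Sum.inr false) (Sum.inr true)) :
    (φ.glue a G n).IsPointed (Sum.inr out) (g + γ) (n + 1) p' (L + L') (R + R') := by
  have ha := h.free.1
  have hc := h.cover
  have hpos (v : φ.V) : φ.pos v < 2 * (n : ℝ) := lt_of_mem_points_stdDistribution (hc.pos_mem v)
  have haR : a ∈ φ.rightEnds := mem_rightEnds.mpr ha
  have hleft : (φ.glue a G n).leftEnds.val.map (φ.glue a G n).weight = L + L' := by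
    rw [glue_leftEnds]
    rw [Finset.val_disjSum, Multiset.map_disjSum, ← hG.left_profile, ← hc.left_profile]
    rfl
  have hright : (φ.glue a G n).rightEnds.val.map (φ.glue a G n).weight = p' ::ₘ (R + R') := by
    rw [glue_rightEnds, Finset.val_disjSum, Multiset.map_disjSum]
    have h1 : (φ.rightEnds.erase a).val.map φ.weight = R := by
      have h2 := hc.right_profile
      rw [← Finset.insert_erase haR, Finset.insert_val_of_notMem (Finset.notMem_erase _ _),
        Multiset.map_cons, h.weight_eq] at h2
      exact (Multiset.cons_inj_right p).mp h2
    refine (congrArg₂ (· + ·) h1 hG.right_profile).trans ?_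
    simp
  refine ⟨⟨?_, ?_, ?_, glue_connected hc.connected ha hG, ?_, ?_, ?_, hleft, hright⟩, ?_, ?_, ?_,
    hG.out_weight, hp'⟩
  · rintro (e | i) (v | b) (w | c) h1 h2 <;> simp at h1 h2
    · have hea : e ≠ a := by rintro rfl; simp at h2
      simp [hea] at h2
      exact hc.increasing e v w h1 h2
    · refine (hpos v).trans_le ?_
      cases c <;> simp
    · obtain ⟨rfl, rfl⟩ := hG.increasing i b c h1 h2
      simp
  · rintro (e | i)
    exacts [hc.weight_pos e, hG.weight_pos i]
  · rintro (v | b)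
    · rw [glue_inEdges_inl _ _ _ _ ha, glue_outEdges_inl]
      have := hc.trivalent v
      simpa using this
    · rw [glue_inEdges_inr, glue_outEdges_inr]
      have := hG.trivalent b
      have e : (if b = G.att then {a} else ∅ : Finset φ.E).card = if b = G.att then 1 else 0 := by
        split <;> simp
      erw [Finset.card_disjSum, Finset.card_disjSum]
      simpa [e] using this
  · have h1 := hc.genus
    have h2 := congrArg Multiset.card hleft
    have h3 := congrArg Multiset.card hright
    simp only [Multiset.card_map, Multiset.card_add, Multiset.card_cons, Finset.card_val] at h2 h3
    rw [h2, h3]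
    rw [hc.card_leftEnds, hc.card_rightEnds, Multiset.card_cons] at h1
    have h4 := hG.genus
    have e1 : Fintype.card (φ.glue a G n).E = Fintype.card φ.E + G.n := by
      refine (Fintype.card_sum (α := φ.E) (β := Fin G.n)).trans (by simp)
    have e2 : Fintype.card (φ.glue a G n).V = Fintype.card φ.V + 2 := by
      refine (Fintype.card_sum (α := φ.V) (β := Bool)).trans (by simp)
    omega
  · change Set.range (Sum.elim φ.pos _) = _
    rw [Set.Sum.elim_range, hc.image, points_stdDistribution_succ]
    congr 1
    ext r
    simp
  · rintro (v | b)
    · rw [glue_inEdges_inl _ _ _ _ ha, glue_outEdges_inl]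
      have := hc.balanced v
      erw [Finset.sum_disjSum, Finset.sum_disjSum]
      simpa using this
    · rw [glue_inEdges_inr, glue_outEdges_inr]
      have := hG.balanced b
      have e : ∑ x ∈ (if b = G.att then {a} else ∅ : Finset φ.E), φ.weight x
          = if b = G.att then p else 0 := by
        split <;> simp [h.weight_eq]
      erw [Finset.sum_disjSum, Finset.sum_disjSum]
      simpa [e] using this
  · intro i
    refine Fin.lastCases ?_ (fun j => ?_) i
    · exact ⟨Sum.inr false, Sum.inr true, by simp [stdDistribution], by simp [stdDistribution], hres⟩
    · obtain ⟨v₁, v₂, h1, h2, h3⟩ := h.resolving j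
      exact ⟨Sum.inl v₁, Sum.inl v₂, h1, h2, h3.glue h.free⟩
  · rintro (e | i) he hw
    -- The edge `a` is no longer an end and is not contractible, so its weight must not be even.
    · by_cases hea : e = a
      · subst hea
        exact absurd h.odd (Nat.not_odd_iff_even.mpr (h.weight_eq ▸ hw))
      · obtain ⟨j, v₁, v₂, h1, h2, h3, h4⟩ := h.even_contractible e
          (fun h => he (h.imp (by simp +contextual) (by simp +contextual [hea]))) hw
        exact ⟨j.castSucc, Sum.inl v₁, Sum.inl v₂, h1, h2, by simp [h3], by simp [h4, hea]⟩
    · rcases hs : G.src i with _ | b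
      · exact absurd (Or.inl (by simp [hs])) he
      rcases ht : G.tgt i with _ | c
      · exact absurd (Or.inr (by simp [ht])) he
      obtain ⟨rfl, rfl⟩ := hG.increasing i b c hs ht
      exact ⟨Fin.last n, Sum.inr false, Sum.inr true, by simp [stdDistribution],
        by simp [stdDistribution], by simp [hs], by simp [ht]⟩
  · refine ⟨by simp [hG.out_tgt], ?_⟩
    rintro (e | i) hne ht
    · rcases hs : G.src out with _ | b
      · exact absurd hs hG.out_src
      · rcases φ.src e <;> simp [*]
    · have := hG.out_free i (by rintro rfl; exact hne rfl) (by simpa using ht)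
      intro h
      exact this (Option.map_injective Sum.inr_injective h)

/-! ### Truncation recovers the cover from its prolongations -/

open Classical in
/-- The part of a cover over `(-∞, c)`. -/
noncomputable abbrev truncate (φ : CoverData) (c : ℝ) : CoverData where
  V := {v : φ.V // φ.pos v < c}
  E := {e : φ.E // ∃ v, φ.Inc e v ∧ φ.pos v < c}
  src e := (φ.src e).bind fun v => if h : φ.pos v < c then some ⟨v, h⟩ else none
  tgt e := (φ.tgt e).bind fun v => if h : φ.pos v < c then some ⟨v, h⟩ else none
  pos v := φ.pos v
  weight e := φ.weight e

theorem Iso.inc_iff {φ ψ : CoverData} (f : Iso φ ψ) {e : φ.E} {v : φ.V} :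
    ψ.Inc (f.onE e) (f.onV v) ↔ φ.Inc e v := by
  simp [Inc, f.src_eq, f.tgt_eq]

/-- Isomorphic covers have isomorphic truncations. -/
def Iso.truncate {φ ψ : CoverData} (f : Iso φ ψ) (c : ℝ) : Iso (φ.truncate c) (ψ.truncate c) where
  onV := f.onV.subtypeEquiv fun v => by rw [f.pos_eq]
  onE := f.onE.subtypeEquiv fun e => by
    rw [← f.onV.exists_congr_right]
    simp only [f.inc_iff, f.pos_eq]
  src_eq := by
    rintro ⟨e, he⟩
    have h := f.src_eq e
    cases hs : φ.src e with
    | none => simp [h, hs]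
    | some v => by_cases hv : φ.pos v < c <;> simp [h, hs, f.pos_eq, hv]
  tgt_eq := by
    rintro ⟨e, he⟩
    have h := f.tgt_eq e
    cases hs : φ.tgt e with
    | none => simp [h, hs]
    | some v => by_cases hv : φ.pos v < c <;> simp [h, hs, f.pos_eq, hv]
  pos_eq v := f.pos_eq v
  weight_eq e := f.weight_eq e

/-- A cover is its own truncation above all of its inner vertices. -/
theorem nonempty_iso_truncate_self (φ : CoverData) {c : ℝ} (hc : ∀ v, φ.pos v < c)
    (hinc : ∀ e, ∃ v, φ.Inc e v) : Nonempty (Iso (φ.truncate c) φ) := by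
  refine ⟨⟨Equiv.subtypeUnivEquiv hc, Equiv.subtypeUnivEquiv fun e => ?_, ?_, ?_, fun _ => rfl,
    fun _ => rfl⟩⟩
  · obtain ⟨v, hv⟩ := hinc e
    exact ⟨v, hv, hc v⟩
  · rintro ⟨e, he⟩
    cases hs : φ.src e <;> simp [hs, hc]
  · rintro ⟨e, he⟩
    cases hs : φ.tgt e <;> simp [hs, hc]

/-- Gluing a gadget does not change the truncation below the gadget. -/
theorem nonempty_iso_truncate_glue (φ : CoverData) {a : φ.E} (ha : φ.tgt a = none) (G : Gadget)
    {n : ℕ} {c : ℝ} (hc : c ≤ 2 * (n : ℝ)) :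
    Nonempty (Iso ((φ.glue a G n).truncate c) (φ.truncate c)) := by
  have hnew (b : Bool) : ¬ (if b then 2 * (n : ℝ) + 1 else 2 * (n : ℝ)) < c := by
    cases b <;> simp <;> linarith
  let fV : (φ.truncate c).V → ((φ.glue a G n).truncate c).V := fun v => ⟨Sum.inl v.1, v.2⟩
  let fE : (φ.truncate c).E → ((φ.glue a G n).truncate c).E := fun e =>
    ⟨Sum.inl e.1, by
      obtain ⟨v, h1, h2⟩ := e.2
      exact ⟨Sum.inl v, h1.glue ha, h2⟩⟩
  have hV : Function.Bijective fV := by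
    refine ⟨fun v w h => Subtype.ext (Sum.inl_injective (congrArg Subtype.val h)), ?_⟩
    rintro ⟨v | b, h⟩
    · exact ⟨⟨v, h⟩, rfl⟩
    · exact absurd h (hnew b)
  have hE : Function.Bijective fE := by
    refine ⟨fun v w h => Subtype.ext (Sum.inl_injective (congrArg Subtype.val h)), ?_⟩
    rintro ⟨e | i, v | b, h1, h2⟩
    · refine ⟨⟨e, v, ?_, h2⟩, rfl⟩
      rcases h1 with h1 | h1
      · exact Or.inl (by simpa using h1)
      · by_cases hea : e = a
        · simp [hea] at h1
        · exact Or.inr (by simpa [hea] using h1)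
    · exact absurd h2 (hnew b)
    · rcases h1 with h1 | h1 <;> simp at h1
    · exact absurd h2 (hnew b)
  refine ⟨Iso.symm ⟨Equiv.ofBijective fV hV, Equiv.ofBijective fE hE, ?_, ?_, fun _ => rfl,
    fun _ => rfl⟩⟩
  · rintro ⟨e, he⟩
    cases hs : φ.src e with
    | none => simp [fE, hs]
    | some v => by_cases hv : φ.pos v < c <;> simp [fE, fV, hs, hv]
  · rintro ⟨e, he⟩
    -- The glued end now runs to a vertex at or beyond $2n\ge c$, so truncation turns it back into
    -- an end.
    by_cases hea : e = a
    · subst hea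
      simp [fE, fV, ha, hnew]
    · cases hs : φ.tgt e with
      | none => simp [fE, hs, hea]
      | some v => by_cases hv : φ.pos v < c <;> simp [fE, fV, hs, hv, hea]

/-! ### Composable prolongations -/

/-- A set of free ends of weight `1` other than `a`. -/
def IsSpare (φ : CoverData) (a : φ.E) (T : Finset φ.E) : Prop :=
  ∀ e ∈ T, e ≠ a ∧ φ.IsFreeEnd e ∧ φ.weight e = 1

/-- Every cover with a distinguished free end of weight `p` can be extended so that a distinguished free
end of weight `p'`, further ends of weights `L'` and `R'`, `ν` free ends of weight `1`, and `γ` cycles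
arise. -/
def Extends (p p' : ℕ) (L' R' : Multiset ℕ) (γ ν : ℕ) : Prop :=
  ∀ (φ : CoverData) (a : φ.E) (g n : ℕ) (L R : Multiset ℕ) (T : Finset φ.E),
    φ.IsPointed a g n p L R → φ.IsSpare a T →
    ∃ (φ' : CoverData) (a' : φ'.E) (k : ℕ) (T' : Finset φ'.E),
      2 * k = L'.card + R'.card + 2 * γ ∧ φ'.IsPointed a' (g + γ) (n + k) p' (L + L') (R + R') ∧
      φ'.IsSpare a' T' ∧ T'.card = T.card + ν ∧
      ∀ c ≤ 2 * (n : ℝ), Nonempty (Iso (φ'.truncate c) (φ.truncate c))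

theorem Extends.refl (p : ℕ) : Extends p p 0 0 0 0 := fun φ a g n L R T h hT =>
  ⟨φ, a, 0, T, by simp, by simpa using h, hT, rfl, fun _ _ => ⟨Iso.refl _⟩⟩

/-- The second prolongation leaves every truncation at height at most $2(n+k_1)$ unchanged, in
particular those at height at most $2n$. -/
theorem Extends.trans {p p' p'' γ γ' ν ν' : ℕ} {L R L' R' : Multiset ℕ} (h : Extends p p' L R γ ν)
    (h' : Extends p' p'' L' R' γ' ν') :
    Extends p p'' (L + L') (R + R') (γ + γ') (ν + ν') := by
  intro φ a g n L₀ R₀ T hφ hT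
  obtain ⟨φ₁, a₁, k₁, T₁, hk₁, hφ₁, hT₁, hc₁, hi₁⟩ := h φ a g n L₀ R₀ T hφ hT
  obtain ⟨φ₂, a₂, k₂, T₂, hk₂, hφ₂, hT₂, hc₂, hi₂⟩ := h' φ₁ a₁ _ _ _ _ T₁ hφ₁ hT₁
  refine ⟨φ₂, a₂, k₁ + k₂, T₂, ?_, ?_, hT₂, by omega, fun c hc => ?_⟩
  · simp only [Multiset.card_add]; omega
  · simpa only [add_assoc] using hφ₂
  · obtain ⟨f⟩ := hi₁ c hc
    obtain ⟨f'⟩ := hi₂ c (hc.trans (by push_cast; have := k₁.cast_nonneg (α := ℝ); linarith))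
    exact ⟨f'.trans f⟩

theorem Extends.congr {p p' γ ν : ℕ} {L R L' R' : Multiset ℕ} (h : Extends p p' L R γ ν)
    (hL : L = L') (hR : R = R') : Extends p p' L' R' γ ν := hL ▸ hR ▸ h

/-- Every edge of a gadget touches a vertex of the gadget, so a new end towards $+\infty$ never
starts at an old vertex. -/
theorem IsFreeEnd.glue {φ : CoverData} {a e : φ.E} {G : Gadget} {n : ℕ} (he : φ.IsFreeEnd e)
    (hea : e ≠ a) (hG : ∀ i, ∃ b, G.src i = some b ∨ G.tgt i = some b) :
    (φ.glue a G n).IsFreeEnd (Sum.inl e) := by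
  refine ⟨by simp [hea, he.1], ?_⟩
  rintro (f | i) hne ht
  · have hfa : f ≠ a := by rintro rfl; simp at ht
    have := he.2 f (by rintro rfl; exact hne rfl) (by simpa [hfa] using ht)
    intro h
    exact this (Option.map_injective Sum.inl_injective h)
  · obtain ⟨b, hb⟩ := hG i
    have ht' : G.tgt i = none := by simpa using ht
    have hb' : G.src i = some b := by simpa [ht'] using hb
    rcases φ.src e <;> simp [hb']

theorem IsSpare.glue {φ : CoverData} {a : φ.E} {G : Gadget} {T : Finset φ.E} {n p p' γ : ℕ}
    {L' R' : Multiset ℕ} {out : Fin G.n} (hT : φ.IsSpare a T) (hG : G.IsValid p p' L' R' γ out)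
    (S : Finset (Fin G.n)) (hS : ∀ i ∈ S, i ≠ out ∧ G.tgt i = none ∧ G.weight i = 1 ∧
      ∃ b, G.src i = some b ∧ ∀ j, j ≠ i → G.tgt j = none → G.src j ≠ some b) :
    (φ.glue a G n).IsSpare (Sum.inr out) (T.disjSum S) := by
  rintro (e | i) he
  · obtain ⟨h1, h2, h3⟩ := hT e (by simpa using he)
    exact ⟨by simp, h2.glue h1 hG.inc, h3⟩
  · obtain ⟨h1, h2, h3, b, hb, h4⟩ := hS i (by simpa using he)
    refine ⟨by simpa using h1, ⟨by simp [h2], ?_⟩, h3⟩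
    rintro (f | j) hne ht
    · rcases φ.src f <;> simp [hb]
    · have := h4 j (by rintro rfl; exact hne rfl) (by simpa using ht)
      rw [← hb] at this
      exact fun h => this (Option.map_injective Sum.inr_injective h)

theorem extends_of_gadget {G : Gadget} {p p' γ : ℕ} {L' R' : Multiset ℕ} {out : Fin G.n}
    (hG : G.IsValid p p' L' R' γ out) (hp' : Odd p')
    (hres : ∀ (φ : CoverData) (a : φ.E) (n : ℕ),
      (φ.glue a G n).IsResolvingPair (Sum.inr false) (Sum.inr true))
    (S : Finset (Fin G.n)) (hS : ∀ i ∈ S, i ≠ out ∧ G.tgt i = none ∧ G.weight i = 1 ∧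
      ∃ b, G.src i = some b ∧ ∀ j, j ≠ i → G.tgt j = none → G.src j ≠ some b) :
    Extends p p' L' R' γ S.card := by
  intro φ a g n L R T h hT
  exact ⟨φ.glue a G n, Sum.inr out, 1, T.disjSum S, hG.card_eq, h.glue hG hp' (hres φ a n),
    hT.glue hG S hS, Finset.card_disjSum _ _,
    fun c hc => nonempty_iso_truncate_glue φ h.free.1 G hc⟩

end CoverData

/-! ### The four gadgets -/

/-- Two new ends of weight `q` merge, and the resulting edge merges with the distinguished end. -/
abbrev mergeMergeGadget (p q : ℕ) : Gadget where
  n := 4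
  src := ![none, none, some false, some true]
  tgt := ![some false, some false, some true, none]
  weight := ![q, q, 2 * q, p + 2 * q]
  att := true

/-- An edge of weight `2 * q` splits off from the distinguished end, and splits into two ends of weight `q`. -/
abbrev splitSplitGadget (p q : ℕ) : Gadget where
  n := 4
  src := ![some false, some false, some true, some true]
  tgt := ![some true, none, none, none]
  weight := ![2 * q, p, q, q]
  att := false

/-- The distinguished end splits into an end of weight `b` and an edge of weight `2`, which merges with a
new end of weight `d`. -/
abbrev splitMergeGadget (b d : ℕ) : Gadget where
  n := 4
  src := ![some false, some false, none, some true]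
  tgt := ![none, some true, some true, none]
  weight := ![b, 2, d, d + 2]
  att := false

/-- The distinguished end of weight `3` splits into two edges which merge again. -/
abbrev cycleGadget : Gadget where
  n := 3
  src := ![some false, some false, some true]
  tgt := ![some true, some true, none]
  weight := ![1, 2, 3]
  att := false

namespace CoverData

theorem glue_inEdges_inr_of_ne (φ : CoverData) (a : φ.E) {G : Gadget} (n : ℕ) {b : Bool}
    {S : Finset (Fin G.n)} (hb : b ≠ G.att) (hS : (Finset.univ.filter fun i => G.tgt i = some b) = S) :
    (φ.glue a G n).inEdges (Sum.inr b) = S.map Function.Embedding.inr := by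
  rw [glue_inEdges_inr, if_neg hb, hS, Finset.empty_disjSum]

theorem glue_inEdges_inr_of_eq (φ : CoverData) (a : φ.E) {G : Gadget} (n : ℕ) {b : Bool}
    {S : Finset (Fin G.n)} (hb : b = G.att) (hS : (Finset.univ.filter fun i => G.tgt i = some b) = S) :
    (φ.glue a G n).inEdges (Sum.inr b) = insert (Sum.inl a) (S.map Function.Embedding.inr) := by
  rw [glue_inEdges_inr, if_pos hb, hS]
  ext (x | x) <;> simp

theorem glue_outEdges_inr_of_eq (φ : CoverData) (a : φ.E) {G : Gadget} (n : ℕ) {b : Bool}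
    {S : Finset (Fin G.n)} (hS : (Finset.univ.filter fun i => G.src i = some b) = S) :
    (φ.glue a G n).outEdges (Sum.inr b) = S.map Function.Embedding.inr := by
  rw [glue_outEdges_inr, hS, Finset.empty_disjSum]

theorem mergeMergeGadget_isValid (p : ℕ) {q : ℕ} (hq : 0 < q) :
    (mergeMergeGadget p q).IsValid p (p + 2 * q) {q, q} 0 0 (3 : Fin 4) := by
  have hl : (Finset.univ.filter fun i => (mergeMergeGadget p q).src i = none) =
    ({0, 1} : Finset (Fin 4)) := rfl
  have hr : (Finset.univ.filter fun i => (mergeMergeGadget p q).tgt i = none) =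
    ({3} : Finset (Fin 4)) := rfl
  constructor
  · simp [Fin.forall_fin_succ]
  · exact ⟨(2 : Fin 4), rfl, rfl⟩
  · simp [Fin.forall_fin_succ]
  · simp [Fin.forall_fin_succ]; omega
  · rintro (_ | _) <;> rfl
  · simp [Finset.sum_filter, Fin.sum_univ_four]; omega
  · rw [hl]; simp
  · rw [hr]; simp
  · simp
  · simp
  · rfl
  · simp [Fin.forall_fin_succ]
  · simp
  · rfl

theorem glue_mergeMergeGadget_isResolvingPair (p q : ℕ) (φ : CoverData) (a : φ.E) (n : ℕ) :
    (φ.glue a (mergeMergeGadget p q) n).IsResolvingPair (Sum.inr false) (Sum.inr true) := by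
  refine .mergeMerge (Sum.inr (0 : Fin 4)) (Sum.inr (1 : Fin 4)) (Sum.inr (2 : Fin 4)) (Sum.inl a)
    (Sum.inr (3 : Fin 4)) ?_ ?_ ?_ ?_ ?_
  · rw [glue_inEdges_inr_of_ne φ a n (S := ({0, 1} : Finset (Fin 4))) (by simp) rfl]
    simp
  · rw [glue_outEdges_inr_of_eq φ a n (S := ({2} : Finset (Fin 4))) rfl]
    simp
  · rw [glue_inEdges_inr_of_eq φ a n (S := ({2} : Finset (Fin 4))) (by simp) rfl]
    simp [Finset.pair_comm]
  · rw [glue_outEdges_inr_of_eq φ a n (S := ({3} : Finset (Fin 4))) rfl]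
    simp
  · exact Or.inr ⟨_, _, Sum.inr false, by simp, rfl, rfl, Or.inl rfl, Or.inl rfl, Or.inr rfl,
      Or.inr rfl⟩

theorem extends_mergeMerge {p q : ℕ} (hp : Odd p) (hq : 0 < q) :
    Extends p (p + 2 * q) {q, q} 0 0 0 :=
  extends_of_gadget (mergeMergeGadget_isValid p hq) (hp.add_even (even_two_mul q))
    (glue_mergeMergeGadget_isResolvingPair p q) ∅ (by simp)

theorem extends_splitSplit {p q : ℕ} (hp : Odd p) (hq : 0 < q) :
    Extends (p + 2 * q) p 0 {q, q} 0 0 := by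
  refine extends_of_gadget (G := splitSplitGadget p q) (out := (1 : Fin 4)) ?_ hp ?_ ∅ (by simp)
  · have hl : (Finset.univ.filter fun i => (splitSplitGadget p q).src i = none) =
      (∅ : Finset (Fin 4)) := rfl
    have hr : (Finset.univ.filter fun i => (splitSplitGadget p q).tgt i = none) =
      ({1, 2, 3} : Finset (Fin 4)) := rfl
    have := hp.pos
    constructor
    · simp [Fin.forall_fin_succ]
    · exact ⟨(0 : Fin 4), rfl, rfl⟩
    · simp [Fin.forall_fin_succ]
    · simp [Fin.forall_fin_succ]; omega
    · rintro (_ | _) <;> rfl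
    · simp [Finset.sum_filter, Fin.sum_univ_four]; omega
    · rw [hl]; simp
    · rw [hr]; simp
    · simp
    · simp
    · rfl
    · simp [Fin.forall_fin_succ]
    · simp
    · rfl
  · intro φ a n
    refine .splitSplit (Sum.inr (2 : Fin 4)) (Sum.inr (3 : Fin 4)) (Sum.inr (0 : Fin 4))
      (Sum.inr (1 : Fin 4)) (Sum.inl a) ?_ ?_ ?_ ?_ ?_
    · rw [glue_outEdges_inr_of_eq φ a n (S := ({2, 3} : Finset (Fin 4))) rfl]
      simp
    · rw [glue_inEdges_inr_of_ne φ a n (S := ({0} : Finset (Fin 4))) (by simp) rfl]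
      simp
    · rw [glue_outEdges_inr_of_eq φ a n (S := ({0, 1} : Finset (Fin 4))) rfl]
      simp
    · rw [glue_inEdges_inr_of_eq φ a n (S := (∅ : Finset (Fin 4))) (by simp) rfl]
      simp
    · exact Or.inr ⟨_, _, Sum.inr true, by simp, rfl, rfl, Or.inr rfl, Or.inr rfl, Or.inl rfl,
        Or.inl rfl⟩

theorem splitMergeGadget_isValid {b d : ℕ} (hb : 0 < b) (hd : 0 < d) :
    (splitMergeGadget b d).IsValid (b + 2) (d + 2) {d} {b} 0 (3 : Fin 4) := by
  have hl : (Finset.univ.filter fun i => (splitMergeGadget b d).src i = none) =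
    ({2} : Finset (Fin 4)) := rfl
  have hr : (Finset.univ.filter fun i => (splitMergeGadget b d).tgt i = none) =
    ({0, 3} : Finset (Fin 4)) := rfl
  constructor
  · simp [Fin.forall_fin_succ]
  · exact ⟨(1 : Fin 4), rfl, rfl⟩
  · simp [Fin.forall_fin_succ]
  · simp [Fin.forall_fin_succ]; omega
  · rintro (_ | _) <;> rfl
  · simp [Finset.sum_filter, Fin.sum_univ_four]; omega
  · rw [hl]; simp
  · rw [hr]; exact Multiset.pair_comm b (d + 2)
  · simp
  · simp
  · rfl
  · simp [Fin.forall_fin_succ]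
  · simp
  · rfl

theorem glue_splitMergeGadget_isResolvingPair (b d : ℕ) (φ : CoverData) (a : φ.E) (n : ℕ) :
    (φ.glue a (splitMergeGadget b d) n).IsResolvingPair (Sum.inr false) (Sum.inr true) := by
  refine .splitMerge (Sum.inl a) (Sum.inr (0 : Fin 4)) (Sum.inr (1 : Fin 4)) (Sum.inr (2 : Fin 4))
    (Sum.inr (3 : Fin 4)) ?_ ?_ ?_ ?_ (by simp)
  · rw [glue_inEdges_inr_of_eq φ a n (S := (∅ : Finset (Fin 4))) (by simp) rfl]
    simp
  · rw [glue_outEdges_inr_of_eq φ a n (S := ({0, 1} : Finset (Fin 4))) rfl]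
    simp
  · rw [glue_inEdges_inr_of_ne φ a n (S := ({1, 2} : Finset (Fin 4))) (by simp) rfl]
    simp
  · rw [glue_outEdges_inr_of_eq φ a n (S := ({3} : Finset (Fin 4))) rfl]
    simp

theorem extends_splitMerge {b d : ℕ} (hb : 0 < b) (hd : Odd d) :
    Extends (b + 2) (d + 2) {d} {b} 0 0 :=
  extends_of_gadget (splitMergeGadget_isValid hb hd.pos) (hd.add_even even_two)
    (glue_splitMergeGadget_isResolvingPair b d) ∅ (by simp)

/-- The end of weight $1$ that splits off is free, because the other edge leaving its vertex is the
contractible one. This is the source of all spare ends. -/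
theorem extends_splitMerge_one : Extends 3 3 {1} {1} 0 1 :=
  extends_of_gadget (splitMergeGadget_isValid one_pos one_pos) (by decide)
    (glue_splitMergeGadget_isResolvingPair 1 1) {(0 : Fin 4)} (by decide)

/-- An odd weight has to be at least $3$ to split into an odd and an even positive weight; this is
one reason for working at weight $3$. -/
theorem extends_cycle : Extends 3 3 0 0 1 0 := by
  refine extends_of_gadget (G := cycleGadget) (out := (2 : Fin 3)) ?_ (by decide) ?_ ∅ (by simp)
  · constructor <;> decide
  · intro φ a n
    refine .cycle (Sum.inl a) (Sum.inr (0 : Fin 3)) (Sum.inr (1 : Fin 3)) (Sum.inr (2 : Fin 3))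
      ?_ ?_ ?_ ?_ even_two
    · rw [glue_inEdges_inr_of_eq φ a n (S := (∅ : Finset (Fin 3))) (by simp) rfl]
      simp
    · rw [glue_outEdges_inr_of_eq φ a n (S := ({0, 1} : Finset (Fin 3))) rfl]
      simp
    · rw [glue_inEdges_inr_of_ne φ a n (S := ({0, 1} : Finset (Fin 3))) (by simp) rfl]
      simp
    · rw [glue_outEdges_inr_of_eq φ a n (S := ({2} : Finset (Fin 3))) rfl]
      simp

/-! ### Inserting the parts of the partitions and the genus -/

/-- Raise the weight of the distinguished end by means of ends of weight `1`. -/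
theorem extends_raise {p : ℕ} (hp : Odd p) (j : ℕ) :
    Extends p (p + 2 * j) (Multiset.replicate (2 * j) 1) 0 0 0 := by
  induction j with
  | zero => exact Extends.refl p
  | succ j ih =>
    refine (ih.trans (extends_mergeMerge (hp.add_even (even_two_mul j)) one_pos)).congr ?_ rfl
    rw [mul_add, Multiset.replicate_add]
    rfl

/-- Lower the weight of the distinguished end by means of ends of weight `1`. -/
theorem extends_lower {p : ℕ} (hp : Odd p) (j : ℕ) :
    Extends (p + 2 * j) p 0 (Multiset.replicate (2 * j) 1) 0 0 := by
  induction j with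
  | zero => exact Extends.refl p
  | succ j ih =>
    refine ((extends_splitSplit (hp.add_even (even_two_mul j)) one_pos).trans ih).congr rfl ?_
    rw [mul_add, Multiset.replicate_add, add_comm]
    rfl

/-- The end of weight $3$ sheds an end of weight $1$ and absorbs the part $q$, which gives weight
$q+2$. Lowering this to $3$ sheds the remaining $q-1$ ones. -/
theorem extends_left_odd {q : ℕ} (hq : Odd q) : Extends 3 3 {q} (Multiset.replicate q 1) 0 0 := by
  obtain ⟨j, rfl⟩ := hq
  have h : Extends (2 * j + 1 + 2) 3 0 (Multiset.replicate (2 * j) 1) 0 0 := by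
    rw [show 2 * j + 1 + 2 = 3 + 2 * j by ring]
    exact extends_lower (by decide) j
  refine ((extends_splitMerge one_pos ⟨j, rfl⟩).trans h).congr (add_zero _) ?_
  rw [add_comm (2 * j), Multiset.replicate_add]
  rfl

/-- The mirror procedure: $q-1$ ones raise the weight to $q+2$; then $q$ splits off, and the
remaining edge of weight $2$ merges with one more end of weight $1$. -/
theorem extends_right_odd {q : ℕ} (hq : Odd q) : Extends 3 3 (Multiset.replicate q 1) {q} 0 0 := by
  have h' := extends_splitMerge hq.pos (d := 1) (by decide)
  obtain ⟨j, rfl⟩ := hq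
  have h : Extends 3 (2 * j + 1 + 2) (Multiset.replicate (2 * j) 1) 0 0 0 := by
    rw [show 2 * j + 1 + 2 = 3 + 2 * j by ring]
    exact extends_raise (by decide) j
  refine (h.trans h').congr ?_ (zero_add _)
  rw [Multiset.replicate_add]
  rfl

/-- A pair of equal parts enters as a symmetric fork, whatever its parity. This is why even parts
must occur with even multiplicity. -/
theorem extends_left_pair {q : ℕ} (hq : 0 < q) :
    Extends 3 3 {q, q} (Multiset.replicate (2 * q) 1) 0 0 :=
  ((extends_mergeMerge (by decide) hq).trans (extends_lower (by decide) q)).congr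
    (by simp) (by simp)

theorem extends_right_pair {q : ℕ} (hq : 0 < q) :
    Extends 3 3 (Multiset.replicate (2 * q) 1) {q, q} 0 0 :=
  ((extends_raise (by decide) q).trans (extends_splitSplit (by decide) hq)).congr
    (by simp) (by simp)

theorem extends_genus (g : ℕ) : Extends 3 3 0 0 g 0 := by
  induction g with
  | zero => exact Extends.refl 3
  | succ g ih => exact ih.trans extends_cycle

end CoverData

/-- Induction on the partitions in which every even number occurs an even number of times. -/
theorem evenTail_induction {P : Multiset ℕ → Prop} (zero : P 0)
    (odd : ∀ q s, Odd q → P s → P (q ::ₘ s)) (pair : ∀ q s, 0 < q → P s → P (q ::ₘ q ::ₘ s))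
    (s : Multiset ℕ) (hpos : ∀ q ∈ s, 0 < q) (hs : (evenTail s).card = 0) : P s := by
  have hcount : ∀ q, Even q → Even (s.count q) := by
    intro q hq
    by_contra hodd
    rw [Nat.not_even_iff_odd] at hodd
    have hmem : q ∈ evenTail s := by
      simp only [evenTail, Multiset.mem_filter, Multiset.mem_dedup]
      exact ⟨Multiset.count_pos.mp hodd.pos, hq, hodd⟩
    rw [Multiset.card_eq_zero.mp hs] at hmem
    simp at hmem
  clear hs
  induction s using Multiset.strongInductionOn with
  | ih s ih =>
    rcases s.empty_or_exists_mem with rfl | ⟨q, hq⟩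
    · exact zero
    obtain ⟨t, rfl⟩ := Multiset.exists_cons_of_mem hq
    rcases Nat.even_or_odd q with he | ho
    · have hqt : q ∈ t := by
        have := hcount q he
        rw [Multiset.count_cons_self] at this
        rw [← Multiset.count_pos]
        rcases Nat.eq_zero_or_pos (t.count q) with h0 | h0
        · simp [h0] at this
        · exact h0
      obtain ⟨u, rfl⟩ := Multiset.exists_cons_of_mem hqt
      refine pair q u (hpos q hq) (ih u ?_ (fun r hr => hpos r (by simp [hr])) fun r hr => ?_)
      · exact (Multiset.lt_cons_self u q).trans (Multiset.lt_cons_self _ q)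
      · have := hcount r hr
        by_cases hrq : r = q
        · subst hrq
          rw [Multiset.count_cons_self, Multiset.count_cons_self] at this
          simpa [Nat.even_add_one] using this
        · rwa [Multiset.count_cons_of_ne hrq, Multiset.count_cons_of_ne hrq] at this
    · refine odd q t ho (ih t (Multiset.lt_cons_self t q) (fun r hr => hpos r (by simp [hr]))
        fun r hr => ?_)
      have := hcount r hr
      rwa [Multiset.count_cons_of_ne (by rintro rfl; exact (Nat.not_even_iff_odd.mpr ho) hr)] at this

namespace CoverData

theorem extends_left (s : Multiset ℕ) (hpos : ∀ q ∈ s, 0 < q) (hs : (evenTail s).card = 0) :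
    Extends 3 3 s (Multiset.replicate s.sum 1) 0 0 := by
  refine evenTail_induction (P := fun s => Extends 3 3 s (Multiset.replicate s.sum 1) 0 0)
    (Extends.refl 3) (fun q s hq ih => ?_) (fun q s hq ih => ?_) s hpos hs
  · refine ((extends_left_odd hq).trans ih).congr (by simp) ?_
    rw [Multiset.sum_cons, Multiset.replicate_add]
  · refine ((extends_left_pair hq).trans ih).congr (by simp) ?_
    rw [Multiset.sum_cons, Multiset.sum_cons, ← add_assoc, ← two_mul, Multiset.replicate_add]

theorem extends_right (s : Multiset ℕ) (hpos : ∀ q ∈ s, 0 < q) (hs : (evenTail s).card = 0) :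
    Extends 3 3 (Multiset.replicate s.sum 1) s 0 0 := by
  refine evenTail_induction (P := fun s => Extends 3 3 (Multiset.replicate s.sum 1) s 0 0)
    (Extends.refl 3) (fun q s hq ih => ?_) (fun q s hq ih => ?_) s hpos hs
  · refine ((extends_right_odd hq).trans ih).congr ?_ (by simp)
    rw [Multiset.sum_cons, Multiset.replicate_add]
  · refine ((extends_right_pair hq).trans ih).congr ?_ (by simp)
    rw [Multiset.sum_cons, Multiset.sum_cons, ← add_assoc, ← two_mul, Multiset.replicate_add]

/-- Every cover with a free end of weight `1` extends to profiles `(lam, 1ʰ)`, `(mu, 1ʰ)` and any genus. -/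
theorem extends_partitions {d : ℕ} (lam mu : Nat.Partition d) (hl : (evenTail lam.parts).card = 0)
    (hm : (evenTail mu.parts).card = 0) (g : ℕ) :
    Extends 1 1 (lam.parts + Multiset.replicate (d + 2) 1) (mu.parts + Multiset.replicate (d + 2) 1)
      g 0 := by
  have h1 := extends_left lam.parts (fun q hq => lam.parts_pos hq) hl
  have h2 := extends_right mu.parts (fun q hq => mu.parts_pos hq) hm
  rw [lam.parts_sum] at h1
  rw [mu.parts_sum] at h2
  -- Passing from weight $1$ to weight $3$ and back costs two ones on each side. The parts of $\mu$
  -- cost $d$ ones on the left and those of $\lambda$ cost $d$ ones on the right.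
  have h3 : Extends 1 3 (Multiset.replicate 2 1) 0 0 0 := extends_raise (by decide) 1
  have h4 : Extends 3 1 0 (Multiset.replicate 2 1) 0 0 := extends_lower (by decide) 1
  have h := (((h3.trans h1).trans (extends_genus g)).trans h2).trans h4
  simp only [zero_add, add_zero] at h
  refine h.congr ?_ ?_
  · rw [Multiset.replicate_add]; abel
  · rw [Multiset.replicate_add]; abel

/-! ### Existence of a free end -/

theorem IsSym.exists_pair {φ : CoverData} {p : Finset φ.E} (h : φ.IsSym p) :
    ∃ e₁ e₂, e₁ ≠ e₂ ∧ p = {e₁, e₂} ∧ φ.weight e₁ = φ.weight e₂ := by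
  rcases h with ⟨e₁, e₂, _, _, h1, h2, h3, -⟩ | ⟨e₁, e₂, _, h1, h2, h3, -⟩ <;>
    exact ⟨e₁, e₂, h1, h2, h3⟩

/-- If all even inner edges are contractible, some end of odd weight towards `+∞` is free: an inner vertex as far
to the right as possible among those having an outgoing odd edge and no other end towards `+∞` does the
job. -/
theorem exists_isFreeEnd {φ : CoverData} {g s : ℕ} {L R : Multiset ℕ} {z : BranchDistribution s 0}
    (hc : φ.IsTropicalCover g L R z) (hr : φ.IsResolving z)
    (hev : ∀ e, ¬ φ.IsEnd e → Even (φ.weight e) → φ.IsContractible z e)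
    (hs : 2 * s + 2 = L.card + R.card + 2 * g) (hs0 : 0 < s) (hR : ∀ w ∈ R, Odd w) :
    ∃ a, φ.IsFreeEnd a ∧ Odd (φ.weight a) := by
  have hpos := hc.pos_injective hs
  -- A non-contractible edge leaving a vertex is odd: an even one could be neither inner nor, by
  -- `hR`, an end.
  have hodd (e : φ.E) (v : φ.V) (hv : φ.src e = some v) (hne : ¬ φ.IsContractible z e) :
      Odd (φ.weight e) := by
    by_contra h
    rw [Nat.not_odd_iff_even] at h
    by_cases he : φ.IsEnd e
    · have ht : φ.tgt e = none := he.resolve_left (by simp [hv])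
      refine Nat.not_odd_iff_even.mpr h (hR _ ?_)
      rw [← hc.right_profile]
      exact Multiset.mem_map_of_mem _ (mem_rightEnds.mpr ht)
    · exact hne (hev e he h)
  let P : φ.V → Prop := fun v => ∃ f, φ.src f = some v ∧ Odd (φ.weight f) ∧
    ∀ e, φ.src e = some v → e ≠ f → φ.tgt e ≠ none
  have hsingle (i : Fin s) (v : φ.V) (hv : φ.pos v = (z.x i).2) (f : φ.E)
      (hf : φ.outEdges v = {f}) : P v := by
    have hfv : φ.src f = some v := mem_outEdges.mp (by simp [hf])
    refine ⟨f, hfv, hodd f v hfv ?_, fun e he hef => absurd ?_ hef⟩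
    · rintro ⟨j, u, w, hu, -, hfu, -⟩
      obtain rfl : v = u := by simpa [hfv] using hfu
      exact z.fst_ne_snd j i (hu.symm.trans hv)
    · simpa [hf] using mem_outEdges.mpr he
  -- Every pair contains a vertex with property `P`. It can be chosen to be the second one unless an
  -- even edge splits there into a symmetric fork or cycle; then the first vertex qualifies through
  -- its edge `d`, and no odd edge arrives at the second.
  have hpair (i : Fin s) (v₁ v₂ : φ.V) (h1 : φ.pos v₁ = (z.x i).1) (h2 : φ.pos v₂ = (z.x i).2)
      (h : φ.IsResolvingPair v₁ v₂) : P v₂ ∨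
      (P v₁ ∧ ∀ e, φ.tgt e = some v₂ → Even (φ.weight e)) := by
    rcases h with ⟨_, _, _, _, f, _, _, _, h4, _⟩ | ⟨a, b, c, d, f, e1, e2, e3, e4, e5⟩ |
      ⟨_, _, _, _, f, _, _, _, h4, _⟩ | ⟨_, _, _, f, _, _, _, h4, _⟩
    · exact Or.inl (hsingle i v₂ h2 f h4)
    · have hcin (e : φ.E) (he : φ.tgt e = some v₂) : e = c := by
        simpa [e2] using mem_inEdges.mpr he
      have hc2 : φ.tgt c = some v₂ := mem_inEdges.mp (by simp [e2])
      have hd1 : φ.src d = some v₁ := mem_outEdges.mp (by simp [e3])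
      refine Or.inr ⟨⟨d, hd1, hodd d v₁ hd1 ?_, fun e he hed => ?_⟩, fun e he => ?_⟩
      · rintro ⟨j, u, w, hu, hw, hdu, hdw⟩
        obtain rfl : v₁ = u := by simpa [hd1] using hdu
        obtain rfl : i = j := z.fst_inj.mp (h1.symm.trans hu)
        obtain rfl : w = v₂ := hpos (hw.trans h2.symm)
        have := hc.trivalent v₁
        rw [e3, e4, hcin d hdw] at this
        simp at this
      · have : e = c ∨ e = d := by simpa [e3] using mem_outEdges.mpr he
        rw [this.resolve_right hed, hc2]
        simp
      · rw [hcin e he]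
        have := hc.balanced v₂
        obtain ⟨e₁, e₂, hne, hp, hw⟩ := e5.exists_pair
        rw [e2, e1, hp, Finset.sum_pair hne, Finset.sum_singleton, hw] at this
        exact ⟨_, this⟩
    · exact Or.inl (hsingle i v₂ h2 f h4)
    · exact Or.inl (hsingle i v₂ h2 f h4)
  have hne : ∃ v, P v := by
    obtain ⟨v₁, v₂, h1, h2, h3⟩ := hr ⟨0, hs0⟩
    rcases hpair _ v₁ v₂ h1 h2 h3 with h | ⟨h, -⟩
    exacts [⟨_, h⟩, ⟨_, h⟩]
  obtain ⟨v, hv, hmax⟩ := Set.exists_max_image {v | P v} φ.pos (Set.toFinite _) hne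
  obtain ⟨f, hf1, hf2, hf3⟩ := hv
  refine ⟨f, ⟨?_, fun e hef het hes => hf3 e (hes.trans hf1) hef het⟩, hf2⟩
  -- If the odd edge `f` ended at a vertex `w`, the pair of `w` would contain a vertex with property
  -- `P` to the right of `v`; in the exceptional case `w` cannot be the second vertex, because `f`
  -- is odd.
  rcases hw : φ.tgt f with _ | w
  · rfl
  exfalso
  have hlt := hc.increasing f v w hf1 hw
  have hwp := hc.pos_mem w
  rw [z.points_eq_range] at hwp
  obtain ⟨⟨i, b⟩, hi⟩ := hwp
  obtain ⟨v₁, v₂, h1, h2, h3⟩ := hr i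
  have h12 : φ.pos v₁ < φ.pos v₂ := by rw [h1, h2]; exact z.fst_lt_snd i
  rcases hpair i v₁ v₂ h1 h2 h3 with h | ⟨h, he⟩
  · have := hmax v₂ h
    cases b
    · have : φ.pos w = φ.pos v₁ := by rw [h1, ← hi]; rfl
      linarith
    · have : φ.pos w = φ.pos v₂ := by rw [h2, ← hi]; rfl
      linarith
  · cases b
    · have := hmax v₁ h
      have : φ.pos w = φ.pos v₁ := by rw [h1, ← hi]; rfl
      linarith
    · obtain rfl : w = v₂ := hpos (by rw [h2, ← hi]; rfl)
      exact Nat.not_even_iff_odd.mpr hf2 (he f hw)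

theorem IsPointed.isGenZigzag {φ : CoverData} {a : φ.E} {g n p : ℕ} {L R : Multiset ℕ}
    (h : φ.IsPointed a g n p L R) (hn : 0 < n) (hs : 2 * n + 2 = L.card + (p ::ₘ R).card + 2 * g) :
    φ.IsGenZigzag g L (p ::ₘ R) (stdDistribution n) :=
  (isGenZigzag_iff hs hn).mpr ⟨h.cover, h.resolving, h.even_contractible⟩

theorem exists_isPointed {φ : CoverData} {n : ℕ} (hn : 0 < n)
    (h : φ.IsGenZigzag 0 (Multiset.replicate (n + 1) 1) (Multiset.replicate (n + 1) 1)
      (stdDistribution n)) :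
    ∃ a, φ.IsPointed a 0 n 1 (Multiset.replicate (n + 1) 1) (Multiset.replicate n 1) := by
  have hs : 2 * n + 2 = (Multiset.replicate (n + 1) 1).card + (Multiset.replicate (n + 1) 1).card
      + 2 * 0 := by simp; ring
  obtain ⟨hc, hr, hev⟩ := (isGenZigzag_iff hs hn).mp h
  have hR : ∀ w ∈ Multiset.replicate (n + 1) 1, w = 1 := fun w hw => Multiset.eq_of_mem_replicate hw
  obtain ⟨a, ha, -⟩ := exists_isFreeEnd hc hr hev hs hn fun w hw => hR w hw ▸ odd_one
  refine ⟨a, by rwa [← Multiset.replicate_succ], hr, hev, ha, hR _ ?_, odd_one⟩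
  rw [← hc.right_profile]
  exact Multiset.mem_map_of_mem _ (mem_rightEnds.mpr ha.1)

/-- A cover over the first `n` pairs is its own truncation above these. -/
theorem IsTropicalCover.nonempty_iso_truncate {φ : CoverData} {g n : ℕ} {L R : Multiset ℕ}
    (h : φ.IsTropicalCover g L R (stdDistribution n)) (hn : 0 < n) :
    Nonempty (Iso (φ.truncate (2 * (n : ℝ))) φ) := by
  obtain ⟨v, -⟩ : (stdDistribution n).pt (⟨0, hn⟩, false) ∈ Set.range φ.pos := by
    rw [h.image, BranchDistribution.points_eq_range]
    exact Set.mem_range_self _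
  exact φ.nonempty_iso_truncate_self (fun v => lt_of_mem_points_stdDistribution (h.pos_mem v))
    (exists_inc h.connected v)

end CoverData

open CoverData in
/-- Extending covers embeds the classes for `(1ⁿ⁺¹)` into the classes for larger profiles. -/
theorem card_genZigzagClasses_le_of_extends {n s g : ℕ} {L R : Multiset ℕ} (hn : 0 < n)
    (h : Extends 1 1 L R g 0) (hs : 2 * s = 2 * n + L.card + R.card + 2 * g) :
    Nat.card (GenZigzagClasses 0 (Multiset.replicate (n + 1) 1) (Multiset.replicate (n + 1) 1)
      (stdDistribution n)) ≤
    Nat.card (GenZigzagClasses g (Multiset.replicate (n + 1) 1 + L) (Multiset.replicate (n + 1) 1 + R)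
      (stdDistribution s)) := by
  have key (φ : GenZigzagCover 0 (Multiset.replicate (n + 1) 1) (Multiset.replicate (n + 1) 1)
      (stdDistribution n)) : ∃ ψ : GenZigzagCover g (Multiset.replicate (n + 1) 1 + L)
        (Multiset.replicate (n + 1) 1 + R) (stdDistribution s),
      Nonempty (Iso (ψ.1.truncate (2 * (n : ℝ))) φ.1) := by
    obtain ⟨a, ha⟩ := exists_isPointed hn φ.2
    obtain ⟨ψ, b, k, _, hk, hψ, -, -, hi⟩ := h φ.1 a _ _ _ _ ∅ ha (by simp [IsSpare])
    obtain rfl : s = n + k := by omega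
    have hψ' := hψ.isGenZigzag (by omega) (by simp; omega)
    rw [← Multiset.cons_add, ← Multiset.replicate_succ, zero_add] at hψ'
    obtain ⟨f⟩ := hi _ le_rfl
    obtain ⟨f'⟩ := φ.2.cover.nonempty_iso_truncate hn
    exact ⟨⟨ψ, hψ'⟩, ⟨f.trans f'⟩⟩
  choose F hF using key
  refine card_genZigzagClasses_le F ?_
  -- Truncating an isomorphism of the prolongations at $2n$ yields one between the original covers.
  rintro φ ψ ⟨f⟩
  obtain ⟨f1⟩ := hF φ
  obtain ⟨f2⟩ := hF ψ
  exact ⟨(f1.symm.trans (f.truncate _)).trans f2⟩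

/-! ### A factorial family of pairwise non-isomorphic covers -/

namespace CoverData

/-- The cover that consists of a single edge of weight `1` without inner vertices. -/
noncomputable abbrev line : CoverData where
  V := Empty
  E := Unit
  src _ := none
  tgt _ := none
  pos v := v.elim
  weight _ := 1

/-- The seed of the construction. Having no inner vertex it is not a zigzag cover itself, but its
end may already be used for gluing. -/
theorem line_isPointed : line.IsPointed () 0 0 1 {1} 0 where
  cover :=
    { increasing := by simp
      weight_pos := by simp
      trivalent := by simp
      connected := by
        have : Subsingleton (line.V ⊕ line.E) :=
          ⟨by rintro (x | x) (y | y) <;> first | exact x.elim | exact y.elim | rfl⟩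
        have : Nonempty (line.V ⊕ line.E) := ⟨Sum.inr ()⟩
        exact ⟨SimpleGraph.Preconnected.of_subsingleton⟩
      genus := by simp [leftEnds, rightEnds]
      image := by ext r; simp [mem_points_stdDistribution]
      balanced := by simp
      left_profile := by simp [leftEnds]
      right_profile := by simp [rightEnds] }
  resolving i := i.elim0
  even_contractible := by simp
  free := ⟨rfl, fun _ h => absurd rfl h⟩
  weight_eq := rfl
  odd := odd_one

theorem IsPointed.repoint {φ : CoverData} {a b : φ.E} {g n p : ℕ} {L R : Multiset ℕ}
    (h : φ.IsPointed a g n p L R) (hb : φ.IsFreeEnd b) (hw : φ.weight b = p) :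
    φ.IsPointed b g n p L R :=
  { h with free := hb, weight_eq := hw }

/-- Insert `i` pieces that split off a spare end. -/
theorem extends_splitMerge_iterate (i : ℕ) :
    Extends 3 3 (Multiset.replicate i 1) (Multiset.replicate i 1) 0 i := by
  induction i with
  | zero => exact Extends.refl 3
  | succ i ih =>
    refine (ih.trans extends_splitMerge_one).congr ?_ ?_ <;>
    · rw [Multiset.replicate_add]
      rfl

theorem extends_close (i : ℕ) :
    Extends 3 1 (Multiset.replicate i 1) (Multiset.replicate (i + 2) 1) 0 i :=
  ((extends_splitMerge_iterate i).trans (extends_lower (p := 1) odd_one 1)).congr (add_zero _)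
    (Multiset.replicate_add _ _ _).symm

theorem extends_open_close (i : ℕ) :
    Extends 1 1 (Multiset.replicate (i + 2) 1) (Multiset.replicate (i + 2) 1) 0 i := by
  have h := (extends_raise (p := 1) odd_one 1).trans (extends_close i)
  simp only [zero_add] at h
  refine h.congr ?_ rfl
  rw [add_comm i, Multiset.replicate_add]

/-- The end to which a piece merging at its second vertex is glued can be recovered. -/
theorem eq_of_iso_glue_mergeMerge {φ : CoverData} {a b : φ.E} {g n p q q' : ℕ} {L R : Multiset ℕ}
    (h : φ.IsTropicalCover g L R (stdDistribution n)) (hpos : Function.Injective φ.pos) (hn : 0 < n)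
    (ha : φ.IsFreeEnd a) (hb : φ.IsFreeEnd b)
    (f : Iso (φ.glue a (mergeMergeGadget p q) n) (φ.glue b (mergeMergeGadget p q') n)) : a = b := by
  have hlt (v : φ.V) : φ.pos v < 2 * (n : ℝ) := lt_of_mem_points_stdDistribution (h.pos_mem v)
  -- With $n>0$ there is an inner vertex, so by connectedness every end towards $+\infty$ starts at
  -- an inner vertex.
  obtain ⟨v₀, -⟩ : (stdDistribution n).pt (⟨0, hn⟩, false) ∈ Set.range φ.pos := by
    rw [h.image, BranchDistribution.points_eq_range]
    exact Set.mem_range_self _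
  have hsrc (e : φ.E) (he : φ.tgt e = none) : ∃ v, φ.src e = some v := by
    obtain ⟨v, hv⟩ := exists_inc h.connected v₀ e
    exact ⟨v, hv.resolve_right (by simp [he])⟩
  obtain ⟨v, hv⟩ := hsrc a ha.1
  have h1 := f.src_eq (Sum.inl a)
  have h2 := f.tgt_eq (Sum.inl a)
  have h3 := f.pos_eq (Sum.inl v)
  have h4 := f.pos_eq (Sum.inr true)
  simp only [Sum.elim_inl, hv, Option.map_some, if_true] at h1 h2 h3 h4
  generalize f.onE (Sum.inl a) = e at h1 h2
  generalize f.onV (Sum.inl v) = u at h1 h3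
  generalize f.onV (Sum.inr true) = w at h2 h4
  -- An isomorphism preserves positions, and positions below $2n$ determine the vertex, so `v` is
  -- fixed.
  have hu : ∃ u', u = Sum.inl u' := by
    rcases u with u | c
    · exact ⟨u, rfl⟩
    · have := hlt v
      cases c <;> simp at h3 <;> linarith
  obtain ⟨u, rfl⟩ := hu
  obtain rfl : u = v := hpos h3
  -- The image of `a` runs from `v` to the vertex at $2n+1$. Only the glued end `b` joins an old
  -- vertex to that one, so `a` and `b` both start at `v`; being free ends, they agree.
  rcases e with e | i
  · simp at h1
    have he : e = b := by
      by_contra hne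
      rcases w with w | c
      · have := hlt w
        simp at h4
        linarith
      · simp [hne] at h2
    subst he
    by_contra hne
    exact hb.2 a hne ha.1 (by rw [h1, hv])
  · revert h1
    cases (mergeMergeGadget p q').src i <;> simp

theorem IsSpare.exchange {φ : CoverData} {a b : φ.E} {T : Finset φ.E} (hT : φ.IsSpare a T)
    (ha : φ.IsFreeEnd a) (hw : φ.weight a = 1) : φ.IsSpare b ((insert a T).erase b) := by
  intro e he
  rw [Finset.mem_erase, Finset.mem_insert] at he
  obtain ⟨h1, rfl | h2⟩ := he
  · exact ⟨h1, ha, hw⟩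
  · exact ⟨h1, (hT e h2).2⟩

/-- Pairwise non-isomorphic covers of type `(0, 1ⁿ⁺¹, 1ⁿ⁺¹)` with `n = 3 (j + 1) + r`. -/
theorem exists_family (r j : ℕ) : ∃ (ι : Type) (_ : Fintype ι) (F : ι → CoverData)
    (a : ∀ i, (F i).E) (T : ∀ i, Finset (F i).E), Fintype.card ι = (j + 1).factorial ∧
    (∀ i, (F i).IsPointed (a i) 0 (3 * (j + 1) + r) 1 (Multiset.replicate (3 * (j + 1) + r + 1) 1)
      (Multiset.replicate (3 * (j + 1) + r) 1)) ∧
    (∀ i, (F i).IsSpare (a i) (T i)) ∧ (∀ i, j + 1 ≤ (T i).card) ∧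
    ∀ i i', Nonempty (Iso (F i) (F i')) → i = i' := by
  induction j with
  | zero =>
    -- Opening and closing take one pair each, and the $r+1$ pairs in between yield one spare each.
    -- The remainder $r$ is thus absorbed at the start, leaving at least the one spare required.
    obtain ⟨φ, a, k, T, hk, hφ, hT, hc, -⟩ := extends_open_close (r + 1) line () 0 0 {1} 0 ∅
      line_isPointed (by simp [IsSpare])
    simp only [Multiset.card_replicate] at hk
    obtain rfl : k = r + 3 := by omega
    refine ⟨Unit, inferInstance, fun _ => φ, fun _ => a, fun _ => T, rfl, fun _ => ?_, fun _ => hT,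
      fun _ => ?_, fun _ _ _ => rfl⟩
    swap
    · rw [hc]
      omega
    convert hφ using 1
    · ring
    · rw [← Multiset.replicate_one, ← Multiset.replicate_add]
      congr 1
      ring
    · rw [zero_add]
      congr 1
      ring
  | succ j ih =>
    obtain ⟨ι, _, F, a, T, hι, hF, hT, hcard, hiso⟩ := ih
    set n := 3 * (j + 1) + r with hn
    have hn0 : 0 < n := by omega
    -- The distinguished end and at least $j+1$ spares provide $j+2$ candidates.
    have hchoice (i : ι) : Nonempty (Fin (j + 2) ↪ {e // e ∈ insert (a i) (T i)}) := by
      refine Function.Embedding.nonempty_of_card_le ?_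
      rw [Fintype.card_fin, Fintype.card_coe,
        Finset.card_insert_of_notMem fun h => (hT i _ h).1 rfl]
      have := hcard i
      omega
    let c (i : ι) (x : Fin (j + 2)) : (F i).E := ((hchoice i).some x).1
    have hc_inj (i : ι) : Function.Injective (c i) :=
      Subtype.val_injective.comp (hchoice i).some.injective
    have hc_mem (i : ι) (x : Fin (j + 2)) : c i x ∈ insert (a i) (T i) := ((hchoice i).some x).2
    have hc (i : ι) (x : Fin (j + 2)) : (F i).IsFreeEnd (c i x) ∧ (F i).weight (c i x) = 1 := by
      rcases Finset.mem_insert.mp (hc_mem i x) with h | h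
      · rw [h]
        exact ⟨(hF i).free, (hF i).weight_eq⟩
      · exact (hT i _ h).2
    have key (y : ι × Fin (j + 2)) : ∃ (φ : CoverData) (b : φ.E) (S : Finset φ.E),
        φ.IsPointed b 0 (n + 3) 1 (Multiset.replicate (n + 3 + 1) 1) (Multiset.replicate (n + 3) 1) ∧
        φ.IsSpare b S ∧ j + 2 ≤ S.card ∧ Nonempty (Iso (φ.truncate (2 * ((n + 1 : ℕ) : ℝ)))
          ((F y.1).glue (c y.1 y.2) (mergeMergeGadget 1 1) n)) := by
      obtain ⟨i, x⟩ := y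
      have h0 := (hF i).repoint (hc i x).1 (hc i x).2
      have hv := mergeMergeGadget_isValid 1 one_pos
      have h1 := h0.glue hv (by decide) (glue_mergeMergeGadget_isResolvingPair _ _ _ _ _)
      -- The chosen end is used up, but the previously distinguished end becomes a spare, so the
      -- gluing loses none in number.
      have h2 := ((hT i).exchange (b := c i x) (hF i).free (hF i).weight_eq).glue (n := n) hv ∅
        (by simp)
      -- Two further pairs restore weight $1$ and add one spare; a round uses three pairs in all.
      obtain ⟨φ, b, k, S, hk, h3, h4, h5, h6⟩ := extends_close 1 _ _ _ _ _ _ _ h1 h2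
      simp only [Multiset.card_replicate] at hk
      obtain rfl : k = 2 := by omega
      refine ⟨φ, b, S, ?_, h4, ?_, ?_⟩
      · convert h3 using 1
        · rw [show ({1, 1} : Multiset ℕ) = Multiset.replicate 2 1 from rfl, ← Multiset.replicate_add,
            ← Multiset.replicate_add]
        · rw [add_zero, ← Multiset.replicate_add]
      · rw [h5, Finset.card_disjSum, Finset.card_erase_of_mem (hc_mem i x),
          Finset.card_insert_of_notMem fun h => (hT i _ h).1 rfl]
        have := hcard i
        simp
        omega
      · obtain ⟨f⟩ := h6 _ le_rfl
        obtain ⟨f'⟩ := h1.cover.nonempty_iso_truncate (Nat.succ_pos n)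
        exact ⟨f.trans f'⟩
    choose F' b S hF' hS hScard hF'iso using key
    refine ⟨ι × Fin (j + 2), inferInstance, F', b, S, ?_, fun y => ?_, hS, hScard, ?_⟩
    · rw [Fintype.card_prod, hι, Fintype.card_fin, Nat.factorial_succ (j + 1), mul_comm]
    · have : 3 * (j + 1 + 1) + r = n + 3 := by omega
      rw [this]
      exact hF' y
    · rintro ⟨i, x⟩ ⟨i', x'⟩ ⟨f⟩
      obtain ⟨f1⟩ := hF'iso (i, x)
      obtain ⟨f2⟩ := hF'iso (i', x')
      have f3 := (f1.symm.trans (f.truncate _)).trans f2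
      -- Truncation at $2(n+1)$ has isolated the merging gadget. Truncation at $2n$ now recovers the
      -- previous cover, and with it the index; the chosen end is recovered afterwards.
      obtain rfl : i = i' := by
        obtain ⟨k1⟩ := (F i).nonempty_iso_truncate_glue (hc i x).1.1 (mergeMergeGadget 1 1) (n := n) le_rfl
        obtain ⟨k2⟩ := (F i').nonempty_iso_truncate_glue (hc i' x').1.1 (mergeMergeGadget 1 1) (n := n) le_rfl
        obtain ⟨k3⟩ := (hF i).cover.nonempty_iso_truncate hn0
        obtain ⟨k4⟩ := (hF i').cover.nonempty_iso_truncate hn0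
        exact hiso i i' ⟨(k3.symm.trans ((k1.symm.trans (f3.truncate _)).trans k2)).trans k4⟩
      have hpos := (hF i).cover.pos_injective (by simp; ring)
      rw [hc_inj i (eq_of_iso_glue_mergeMerge (hF i).cover hpos hn0 (hc i x).1 (hc i x').1 f3)]

end CoverData

open CoverData in
theorem factorial_le_card_genZigzagClasses_std {n : ℕ} (hn : 3 ≤ n) :
    (n / 3).factorial ≤ Nat.card (GenZigzagClasses 0 (Multiset.replicate (n + 1) 1)
      (Multiset.replicate (n + 1) 1) (stdDistribution n)) := by
  obtain ⟨j, hj⟩ : ∃ j, n / 3 = j + 1 := ⟨n / 3 - 1, by omega⟩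
  obtain ⟨ι, _, F, a, T, hι, hF, -, -, hiso⟩ := exists_family (n % 3) j
  have hn' : 3 * (j + 1) + n % 3 = n := by omega
  rw [hn'] at hF
  rw [hj, ← hι, ← Nat.card_eq_fintype_card]
  have hz (i : ι) : (F i).IsGenZigzag 0 (Multiset.replicate (n + 1) 1) (Multiset.replicate (n + 1) 1)
      (stdDistribution n) := by
    have := (hF i).isGenZigzag (by omega) (by simp; ring)
    rwa [← Multiset.replicate_succ] at this
  exact Nat.card_le_card_of_injective
    (fun i => (Quotient.mk _ ⟨F i, hz i⟩ : GenZigzagClasses 0 _ _ (stdDistribution n)))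
    fun i i' h => hiso i i' (Quotient.exact h)

theorem factorial_le_card_genZigzagClasses {m : ℕ} (hm : 3 < m) (z : BranchDistribution (m - 1) 0) :
    ((m - 1) / 3).factorial ≤ Nat.card (GenZigzagClasses 0 (Multiset.replicate m 1)
      (Multiset.replicate m 1) z) := by
  obtain ⟨n, rfl⟩ : ∃ n, m = n + 1 := ⟨m - 1, by omega⟩
  refine (factorial_le_card_genZigzagClasses_std (n := n) (by omega)).trans
    (card_genZigzagClasses_le_of_distribution (stdDistribution n) z ?_ (by omega))
  simp
  ring

/-! ### Assembling the estimates -/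

/-- The first part of the theorem, with `n₀ = d + 2`. -/
theorem card_genZigzagClasses_le_addOnes {d : ℕ} (lam mu : Nat.Partition d)
    (hl : (evenTail lam.parts).card = 0) (hm : (evenTail mu.parts).card = 0) {g h : ℕ}
    (hh : d + 2 + 3 < h)
    (z : BranchDistribution (tripleCount g (addOnes lam.parts h) (addOnes mu.parts h)) 0)
    (z' : BranchDistribution (h - (d + 2) - 1) 0) :
    Nat.card (GenZigzagClasses 0 (Multiset.replicate (h - (d + 2)) 1)
      (Multiset.replicate (h - (d + 2)) 1) z') ≤
    Nat.card (GenZigzagClasses g (addOnes lam.parts h) (addOnes mu.parts h) z) := by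
  have hs := two_mul_tripleCount lam mu g h (by omega) hl hm
  generalize tripleCount g (addOnes lam.parts h) (addOnes mu.parts h) = s at hs z
  obtain ⟨n, rfl⟩ : ∃ n, h = n + 1 + (d + 2) := ⟨h - (d + 2) - 1, by omega⟩
  have hn : n + 1 + (d + 2) - (d + 2) = n + 1 := by omega
  revert z'
  rw [hn]
  intro z'
  change BranchDistribution n 0 at z'
  refine (card_genZigzagClasses_le_of_distribution z' (stdDistribution n) ?_ (by omega)).trans ?_
  · simp; ring
  have h1 := card_genZigzagClasses_le_of_extends (n := n) (s := s) (by omega)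
    (CoverData.extends_partitions lam mu hl hm g)
    (by simp only [Multiset.card_add, Multiset.card_replicate]; omega)
  have h2 (p : Multiset ℕ) : Multiset.replicate (n + 1) 1 + (p + Multiset.replicate (d + 2) 1)
      = addOnes p (n + 1 + (d + 2)) := by
    rw [addOnes, Multiset.replicate_add (n + 1)]
    abel
  rw [h2, h2] at h1
  refine h1.trans (card_genZigzagClasses_le_of_distribution _ z ?_ (by omega))
  simp only [addOnes, Multiset.card_add, Multiset.card_replicate]
  omega

/-- Each class contributes a power of $2$, hence at least $1$, whatever the parity of its real
multiplicity. -/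
theorem card_genZigzagClasses_le_genZigzagNumber {g s t : ℕ} {L R : Multiset ℕ}
    (z : BranchDistribution s t) : Nat.card (GenZigzagClasses g L R z) ≤ genZigzagNumber g L R z := by
  have := Fintype.ofFinite (GenZigzagClasses g L R z)
  rw [genZigzagNumber, finsum_eq_sum_of_fintype, Nat.card_eq_fintype_card, ← Finset.card_univ,
    Finset.card_eq_sum_ones]
  exact Finset.sum_le_sum fun _ _ => Nat.one_le_two_pow

/-- With $N=\lfloor (h-C)/3\rfloor$, Stirling gives $\ln N!\ge N(\ln N-1)$. Since $N$ is $h/3$ up to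
a constant and $N\ge h/6$ for large $h$, the leading term is $\frac h3\ln h$. -/
theorem one_le_liminf_of_factorial_le {C : ℕ} {Z : ℕ → ℕ}
    (hZ : ∀ᶠ h in atTop, ((h - C) / 3).factorial ≤ Z h) :
    (1 : EReal) ≤ liminf (fun h : ℕ =>
      ((Real.log (Z h) / ((h : ℝ) / 3 * Real.log h) : ℝ) : EReal)) atTop := by
  -- This is the lower bound $\frac{h-(C+2)}3\,(\ln h-\ln 6-1)$ divided by $\frac h3\ln h$.
  let u : ℕ → ℝ := fun h => (1 - (C + 2 : ℝ) / h) * (1 - (Real.log 6 + 1) / Real.log h)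
  have hu : Tendsto u atTop (nhds 1) := by
    have h1 : Tendsto (fun h : ℕ => 1 - (C + 2 : ℝ) / h) atTop (nhds (1 - 0)) :=
      tendsto_const_nhds.sub (tendsto_const_nhds.div_atTop tendsto_natCast_atTop_atTop)
    have h2 : Tendsto (fun h : ℕ => 1 - (Real.log 6 + 1) / Real.log h) atTop (nhds (1 - 0)) :=
      tendsto_const_nhds.sub (tendsto_const_nhds.div_atTop
        (Real.tendsto_log_atTop.comp tendsto_natCast_atTop_atTop))
    simpa using h1.mul h2
  have hu' : Tendsto (fun h => ((u h : ℝ) : EReal)) atTop (nhds ((1 : ℝ) : EReal)) :=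
    (continuous_coe_real_ereal.tendsto 1).comp hu
  rw [← EReal.coe_one, ← hu'.liminf_eq]
  refine liminf_le_liminf ?_
  -- The threshold ensures both $N\ge h/6$ and $h/6\ge3>e$, so that $\ln(h/6)\ge1$. Rounding in the
  -- division by $3$ loses at most $2$, which explains $C+2$.
  filter_upwards [hZ, eventually_ge_atTop (2 * C + 18)] with h hh hC
  rw [EReal.coe_le_coe_iff]
  set N := (h - C) / 3 with hN
  have hN3 : h ≤ 3 * N + (C + 2) := by omega
  have hN0 : N ≠ 0 := by omega
  have hN3' : (h : ℝ) ≤ 3 * N + (C + 2) := by exact_mod_cast hN3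
  have hC' : 2 * (C : ℝ) + 18 ≤ h := by exact_mod_cast hC
  have hC0 : (0 : ℝ) ≤ C := C.cast_nonneg
  have hh0 : (0 : ℝ) < h := by linarith
  have hlog : 1 ≤ Real.log (h / 6) := by
    rw [Real.le_log_iff_exp_le (by positivity)]
    have := Real.exp_one_lt_d9
    linarith
  have hlogN : Real.log (h / 6) ≤ Real.log N :=
    Real.log_le_log (by positivity) (by linarith)
  have hlogh : Real.log (h / 6) = Real.log h - Real.log 6 := Real.log_div hh0.ne' (by norm_num)
  have hlog6 : 0 < Real.log 6 := Real.log_pos (by norm_num)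
  have hlh : 0 < Real.log h := by linarith
  have hfac : (N : ℝ) * (Real.log N - 1) ≤ Real.log (Z h) := by
    have h1 := Stirling.le_log_factorial_stirling hN0
    have h2 : Real.log (N.factorial) ≤ Real.log (Z h) :=
      Real.log_le_log (by positivity) (by exact_mod_cast hh)
    have h3 : 0 ≤ Real.log (2 * Real.pi) := Real.log_nonneg (by have := Real.pi_gt_three; linarith)
    linarith
  have hmain : ((h : ℝ) - (C + 2)) / 3 * (Real.log h - (Real.log 6 + 1)) ≤ Real.log (Z h) := by
    refine le_trans ?_ hfac
    exact mul_le_mul (by linarith) (by linarith) (by linarith) (by positivity)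
  rw [le_div_iff₀ (by positivity)]
  refine le_trans (le_of_eq ?_) hmain
  simp only [u]
  field_simp

end TropicalZigzag

theorem theorem4p3 :
    (∀ (d : ℕ) (lam mu : Nat.Partition d),
      (evenTail lam.parts).card = 0 → (evenTail mu.parts).card = 0 →
      (∃ n₀ : ℕ, ∀ (g h : ℕ), n₀ + 3 < h →
        ∀ (z : BranchDistribution (tripleCount g (addOnes lam.parts h) (addOnes mu.parts h)) 0)
          (z' : BranchDistribution (h - n₀ - 1) 0),
          Nat.card (GenZigzagClasses 0 (Multiset.replicate (h - n₀) 1)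
              (Multiset.replicate (h - n₀) 1) z')
            ≤ Nat.card (GenZigzagClasses g (addOnes lam.parts h) (addOnes mu.parts h) z)) ∧
      (∀ (g : ℕ)
        (z : (h : ℕ) → BranchDistribution
          (tripleCount g (addOnes lam.parts h) (addOnes mu.parts h)) 0),
        (1 : EReal) ≤ liminf (fun h : ℕ =>
          ((Real.log (genZigzagNumber g (addOnes lam.parts h) (addOnes mu.parts h) (z h))
            / ((h : ℝ) / 3 * Real.log h) : ℝ) : EReal)) atTop)) ∧
    (∀ m : ℕ, 3 < m → ∀ z : BranchDistribution (m - 1) 0,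
      ((m - 1) / 3).factorial
        ≤ Nat.card (GenZigzagClasses 0 (Multiset.replicate m 1) (Multiset.replicate m 1) z)) := by
  refine ⟨fun d lam mu hl hm => ⟨⟨d + 2, fun g h hh z z' =>
    card_genZigzagClasses_le_addOnes lam mu hl hm hh z z'⟩, fun g z => ?_⟩,
    fun m hm z => factorial_le_card_genZigzagClasses hm z⟩
  -- The factorial bound is used with $m=h-n_0$ and $n_0=d+2$, so $m-1=h-(d+2+1)$.
  refine one_le_liminf_of_factorial_le (C := d + 2 + 1) ?_
  filter_upwards [eventually_gt_atTop (d + 2 + 3)] with h hh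
  rw [← Nat.sub_sub]
  exact (factorial_le_card_genZigzagClasses (by omega) (stdDistribution _)).trans
    ((card_genZigzagClasses_le_addOnes lam mu hl hm hh (z h) _).trans
      (card_genZigzagClasses_le_genZigzagNumber _))
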